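/- Let $X_1,\dots,X_n$ ($n\ge 2$) be i.i.d. copies of $X=AV+Z$, where $A,V,Z$ are independent, $A$ is Bernoulli with $P(A=1)=1-p$, $V$ has an unknown density $f$, and $Z$ has a known density $k$ with characteristic function $\phi_Z$. Put $\phi_f(t)=\int e^{itx}f(x)\,dx$. For $\alpha,K_\Sigma>0$ let $$\Sigma(\alpha,K_\Sigma)=\Big\{f \text{ a probability density}: \int_{-\infty}^{\infty}|\phi_f(t)|^2(1+|t|^{2\alpha})\,dt\le K_\Sigma\Big\},$$ and let $p^*<1$. Let $u,w$ be kernels with real-valued symmetric Fourier transforms $\phi_u,\phi_w$ supported on $[-1,1]$ such that $\phi_u$ is continuous in a neighbourhood of $0$, $\int_{-1}^1\phi_u(t)\,dt=2$, $|\phi_u(t)|\le U|t|^\alpha$ for all $t$, and $\lim_{t\to0}\phi_u(t)|t|^{-\alpha}$ exists; and $\phi_w(0)=1$, $|\phi_w(t)-1|\le W|t|^\alpha$ for all $t$, and $\int_{-1}^1|\phi_w(t)|^2dt<\infty$, with constants $U,W>0$. For a nonempty set $S\subseteq\{1,\dots,n\}$ of indices let $\phi_S(t)=|S|^{-1}\sum_{j\in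 S}e^{itX_j}$. For $g>0$ put $$p_{S,g}=\frac g2\int_{-1/g}^{1/g}\frac{\phi_S(t)\phi_u(gt)}{\phi_Z(t)}\,dt,\qquad \hat p_{S,g}=\max\big(-1+\epsilon_n,\min(p_{S,g},1-\epsilon_n)\big),\qquad \epsilon_n=\frac{1}{\log(3n)},$$ and for $h>0$ and nonempty $S,S'\subseteq\{1,\dots,n\}$ put $$\hat f_{S,S',h,g}(x)=\frac1{2\pi}\int_{-\infty}^{\infty}e^{-itx}\,\frac{\phi_{S'}(t)-\hat p_{S,g}\,\phi_Z(t)}{(1-\hat p_{S,g})\,\phi_Z(t)}\,\phi_w(ht)\,dt .$$ Assume that $\phi_Z(t)\ne0$ for all $t\in\mathbb R$ and that $\phi_Z$ is integrable. (i) (Ordinary smooth case, with sample splitting.) Suppose that for some $d_0,\beta>0$ we have $|\phi_Z(t)|\ge d_0|t|^{-\beta}$ for all sufficiently large $|t|$. Let $S=\{1,\dots,\lfloor n/2\rfloor\}$, $S'=\{\lfloor n/2\rfloor+1,\dots,n\}$, $h_n=d\,(n-\lfloor n/2\rfloor)^{-1/(2\alpha+2\beta+1)}$ and $g_n=d'\lfloor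 n/2\rfloor^{-1/(2\alpha+2\beta)}$ with constants $d,d'>0$. Then there is a constant $C$, not depending on $n$, such that for all $n\ge2$ $$\sup_{f\in\Sigma(\alpha,K_\Sigma),\,p\in[0,p^*]}\mathbb E_{p,f}\Big[\int_{-\infty}^\infty\big(\hat f_{S,S',h_n,g_n}(x)-f(x)\big)^2dx\Big]\le C\,n^{-2\alpha/(2\alpha+2\beta+1)} .$$ (ii) (Supersmooth case.) Suppose that for some $d_0,\beta,\gamma>0$ and $\beta_0\in\mathbb R$ we have $|\phi_Z(t)|\ge d_0|t|^{\beta_0}e^{-|t|^\beta/\gamma}$ for all sufficiently large $|t|$. Let $S=S'=\{1,\dots,n\}$ and $h_n=g_n=(4/\gamma)^{1/\beta}(\log n)^{-1/\beta}$. Then there is a constant $C$, not depending on $n$, such that for all $n\ge2$ $$\sup_{f\in\Sigma(\alpha,K_\Sigma),\,p\in[0,p^*]}\mathbb E_{p,f}\Big[\int_{-\infty}^\infty\big(\hat f_{S,S',h_n,g_n}(x)-f(x)\big)^2dx\Big]\le C\,(\log n)^{-2\alpha/\beta} .$$ -/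

import Mathlib

open MeasureTheory Filter Topology
open scoped ENNReal

noncomputable section

/-- `f` is a probability density on the real line (with respect to Lebesgue measure). -/
structure IsProbDensity (f : ℝ → ℝ) : Prop where
  nonneg : ∀ x, 0 ≤ f x
  integrable : Integrable f
  integral_eq_one : ∫ x, f x = 1

/-- The law on the real line with density `f`. -/
def densityLaw (f : ℝ → ℝ) : Measure ℝ :=
  volume.withDensity (fun x => ENNReal.ofReal (f x))

/-- The characteristic function `t ↦ ∫ exp (i t x) f x dx` of the law with density `f`,
that is, the Fourier transform of `f`. -/
def densityCF (f : ℝ → ℝ) : ℝ → ℂ :=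
  charFun (densityLaw f)

/-- The Bernoulli law on `{0, 1}` with success probability `1 - p`. -/
def atomLaw (p : ℝ) : Measure ℝ :=
  ENNReal.ofReal p • Measure.dirac 0 + ENNReal.ofReal (1 - p) • Measure.dirac 1

/-- The law of `X = A V + Z`, where `A`, `V`, `Z` are independent, `A` is Bernoulli with success
probability `1 - p`, `V` has density `f` and `Z` has density `k`. -/
def observationLaw (p : ℝ) (f k : ℝ → ℝ) : Measure ℝ :=
  ((atomLaw p).prod ((densityLaw f).prod (densityLaw k))).map
    (fun ω : ℝ × ℝ × ℝ => ω.1 * ω.2.1 + ω.2.2)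

/-- The law of an i.i.d. sample of size `n` of copies of `X = A V + Z`. -/
def sampleLaw (n : ℕ) (p : ℝ) (f k : ℝ → ℝ) : Measure (Fin n → ℝ) :=
  Measure.pi (fun _ => observationLaw p f k)

/-- The class of densities `f` with `∫ |φ_f(t)|² (1 + |t|^(2α)) dt ≤ K`. -/
def sobolevDensities (α K : ℝ) : Set (ℝ → ℝ) :=
  {f | IsProbDensity f ∧
    ∫⁻ t : ℝ, ‖densityCF f t‖ₑ ^ 2 * ENNReal.ofReal (1 + |t| ^ (2 * α)) ≤ ENNReal.ofReal K}

/-- Ordinary smooth error: `φ_Z` has no zeros, is integrable, and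
`d₀ |t|^(-β) ≤ |φ_Z(t)|` for all large `|t|`, for some `d₀ > 0`. -/
structure OrdinarySmooth (φZ : ℝ → ℂ) (β : ℝ) : Prop where
  ne_zero : ∀ t, φZ t ≠ 0
  lower_bound : ∃ d₀ : ℝ, 0 < d₀ ∧ ∀ᶠ t : ℝ in cocompact ℝ, d₀ * |t| ^ (-β) ≤ ‖φZ t‖
  integrable : Integrable φZ

/-- Supersmooth error: `φ_Z` has no zeros, is integrable, and
`d₀ |t|^β₀ exp (-|t|^β / γ) ≤ |φ_Z(t)|` for all large `|t|`, for some `d₀ > 0` and real `β₀`. -/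
structure Supersmooth (φZ : ℝ → ℂ) (β γ : ℝ) : Prop where
  ne_zero : ∀ t, φZ t ≠ 0
  lower_bound : ∃ d₀ β₀ : ℝ, 0 < d₀ ∧
    ∀ᶠ t : ℝ in cocompact ℝ, d₀ * |t| ^ β₀ * Real.exp (-|t| ^ β / γ) ≤ ‖φZ t‖
  integrable : Integrable φZ

/-- The assumptions on the Fourier transform `φ_u` of the kernel `u` used to estimate `p`.
(Such a `φ_u` is bounded with bounded support, hence is the Fourier transform of a square
integrable `u`; the kernel enters the estimators only through `φ_u`.) -/
structure IsAtomKernelFT (φu : ℝ → ℝ) (α : ℝ) : Prop where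
  even : ∀ t, φu (-t) = φu t
  continuous_near_zero : ∀ᶠ t in 𝓝 (0 : ℝ), ContinuousAt φu t
  support_subset : Function.support φu ⊆ Set.Icc (-1) 1
  integrable : Integrable φu
  integral_eq_two : ∫ t in (-1 : ℝ)..1, φu t = 2
  bound : ∃ U : ℝ, 0 < U ∧ ∀ t, |φu t| ≤ U * |t| ^ α
  limit_exists : ∃ L : ℝ, Tendsto (fun t => φu t / |t| ^ α) (𝓝[≠] 0) (𝓝 L)

/-- The assumptions on the Fourier transform `φ_w` of the kernel `w` used to estimate `f`.
(Such a `φ_w` is the Fourier transform of a square integrable `w`; the kernel enters the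
estimator only through `φ_w`.) -/
structure IsDensityKernelFT (φw : ℝ → ℝ) (α : ℝ) : Prop where
  even : ∀ t, φw (-t) = φw t
  support_subset : Function.support φw ⊆ Set.Icc (-1) 1
  at_zero : φw 0 = 1
  bound : ∃ W : ℝ, 0 < W ∧ ∀ t, |φw t - 1| ≤ W * |t| ^ α
  square_integrable : MemLp φw 2 volume

/-- The empirical characteristic function of the observations `X j`, `j ∈ s`. -/
def empCF {n : ℕ} (X : Fin n → ℝ) (s : Finset (Fin n)) (t : ℝ) : ℂ :=
  (s.card : ℂ)⁻¹ * ∑ j ∈ s, Complex.exp (Complex.I * t * X j)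

/-- The indices of the first `⌊n/2⌋` observations. -/
def firstHalf (n : ℕ) : Finset (Fin n) := Finset.univ.filter (fun j => j.val < n / 2)

/-- The indices of the remaining `n - ⌊n/2⌋` observations. -/
def secondHalf (n : ℕ) : Finset (Fin n) := Finset.univ.filter (fun j => n / 2 ≤ j.val)

/-- `(g/2) ∫_{-1/g}^{1/g} φ_emp(t) φ_u(g t) / φ_Z(t) dt` as a complex number; it is real,
see `atomEstimatorC_im`. -/
def atomEstimatorC (φZ : ℝ → ℂ) (φu : ℝ → ℝ) (g : ℝ) (φemp : ℝ → ℂ) : ℂ :=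
  (g / 2 : ℝ) * ∫ t in (-1 / g)..(1 / g), φemp t * (φu (g * t) : ℂ) / φZ t

/-- The estimator of the atom `p`, with bandwidth `g`. -/
def atomEstimator (φZ : ℝ → ℂ) (φu : ℝ → ℝ) (g : ℝ) (φemp : ℝ → ℂ) : ℝ :=
  (atomEstimatorC φZ φu g φemp).re

/-- The estimator of the atom, truncated to `[-1 + ε, 1 - ε]`. -/
def truncAtomEstimator (φZ : ℝ → ℂ) (φu : ℝ → ℝ) (g ε : ℝ) (φemp : ℝ → ℂ) : ℝ :=
  max (-1 + ε) (min (atomEstimator φZ φu g φemp) (1 - ε))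

/-- The estimator of the density `f` at the point `x`, with bandwidth `h` and estimated atom `q`:
`(1/2π) ∫ exp (-i t x) (φ_emp(t) - q φ_Z(t)) / ((1 - q) φ_Z(t)) φ_w(h t) dt`.
Its value is kept as a complex number, whose imaginary part vanishes by symmetry. -/
def densityEstimator (φZ : ℝ → ℂ) (φw : ℝ → ℝ) (h q : ℝ) (φemp : ℝ → ℂ) (x : ℝ) : ℂ :=
  (1 / (2 * Real.pi) : ℝ) *
    ∫ t : ℝ, Complex.exp (-(Complex.I * t * x)) *
      ((φemp t - q * φZ t) / ((1 - q) * φZ t)) * (φw (h * t) : ℂ)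

/-- The density estimator that uses the whole sample for both the atom and the density. -/
def fullEstimator (φZ : ℝ → ℂ) (φu φw : ℝ → ℝ) (n : ℕ) (h g ε : ℝ)
    (X : Fin n → ℝ) : ℝ → ℂ :=
  densityEstimator φZ φw h
    (truncAtomEstimator φZ φu g ε (empCF X Finset.univ)) (empCF X Finset.univ)

/-- The density estimator with sample splitting: the atom is estimated from the first half of the
sample, and the empirical characteristic function of the second half is used for the density. -/
def splitEstimator (φZ : ℝ → ℂ) (φu φw : ℝ → ℝ) (n : ℕ) (h g ε : ℝ)
    (X : Fin n → ℝ) : ℝ → ℂ :=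
  densityEstimator φZ φw h
    (truncAtomEstimator φZ φu g ε (empCF X (firstHalf n))) (empCF X (secondHalf n))

/-- The mean integrated squared error `E_{p,f} ∫ |f̂(x) - f(x)|² dx` of an estimator `f̂`
(a number in `[0, ∞]`). -/
def mise (n : ℕ) (p : ℝ) (f k : ℝ → ℝ) (fhat : (Fin n → ℝ) → ℝ → ℂ) : ℝ≥0∞ :=
  ∫⁻ X, (∫⁻ x : ℝ, ‖fhat X x - (f x : ℂ)‖ₑ ^ 2) ∂(sampleLaw n p f k)

/-- The worst-case mean integrated squared error over the Sobolev class and `p ∈ [0, p*]`. -/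
def worstMise (n : ℕ) (α K pstar : ℝ) (k : ℝ → ℝ) (fhat : (Fin n → ℝ) → ℝ → ℂ) : ℝ≥0∞ :=
  ⨆ f ∈ sobolevDensities α K, ⨆ p ∈ Set.Icc (0 : ℝ) pstar, mise n p f k fhat

lemma empCF_neg {n : ℕ} (X : Fin n → ℝ) (s : Finset (Fin n)) (t : ℝ) :
    empCF X s (-t) = (starRingEnd ℂ) (empCF X s t) := by
  simp [empCF, ← Complex.exp_conj]

/-- The estimator of the atom is real. -/
lemma atomEstimatorC_im {n : ℕ} (k φu : ℝ → ℝ) (hu : ∀ t, φu (-t) = φu t) (g : ℝ)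
    (X : Fin n → ℝ) (s : Finset (Fin n)) :
    (atomEstimatorC (densityCF k) φu g (empCF X s)).im = 0 := by
  rw [← Complex.conj_eq_iff_im, atomEstimatorC, map_mul, Complex.conj_ofReal]
  congr 1
  rw [← intervalIntegral.intervalIntegral_conj]
  have h := intervalIntegral.integral_comp_neg (a := -1 / g) (b := 1 / g)
    (fun t : ℝ => empCF X s t * (φu (g * t) : ℂ) / densityCF k t)
  rw [neg_div, neg_neg] at h
  rw [neg_div, ← h]
  refine intervalIntegral.integral_congr fun t _ => ?_
  simp [empCF_neg, densityCF, charFun_neg, hu]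

end

/-! Plancherel turns the integrated squared error into a Fourier-side integral. Since `φ_X = (p + (1
- p) φ_f) φ_Z`, with `q` the estimated atom the Fourier error splits exactly into `(1 - q)⁻¹ φ_w(ht)
(φ_emp - φ_X) / φ_Z`, `-(1 - φ_f) φ_w(ht) (q - p) / (1 - q)` and `φ_f (φ_w(ht) - 1)`; see
`lintegral_densityEstimator_sub_sq_le`. The last term is the bias, of squared size `h^(2α)`. The
first has variance of order `sup |φ_Z|⁻² / (n h)`, apart from `(1 - q)⁻²`. The second costs `1/h`
times the mean square of `(q - p) / (1 - q)`.

The atom estimator has squared bias of order `g^(2α+1)` (`sq_integral_atomScore_sub_le`) and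
variance of order `g sup |φ_Z|⁻² / n` (`integral_atomScore_sq_le`). The additional factor `g` in
both offsets `1/h`; in the variance it comes from the integrability of `φ_Z` through
`integral_normSq_charIntegral_le`.

Truncation gives `(1 - q)⁻¹ ≤ L = log (3n)`, and the remaining work is to keep `L` out of the rate.
In the ordinary smooth case splitting makes the factor `(1 - q)⁻²` independent of the empirical
characteristic function, so its mean suffices, and the smaller bandwidth `g` leaves a polynomial
margin that absorbs `L²` in the atom error. In the supersmooth case stochastic terms are `n^(-1/2)`
up to logarithms, so `L²` is harmless there; but the atom bias divided by `h` is already of the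
target order `h^(2α)`, and `atomError_sq_le_of_bias` keeps `L` away from it. -/

noncomputable section

/-! ### Plancherel's identity for the error of a Fourier inversion. -/

open SchwartzMap FourierTransform in
-- The L² inverse transform is defined abstractly, with no pointwise formula. Regarded as tempered
-- distributions, `E` and that transform pair equally with every Schwartz function, and smooth
-- compactly supported tests determine a locally integrable function.
theorem ae_eq_fourierInv_of_integral_schwartz {E : ℝ → ℂ} (hE : LocallyIntegrable E)
    {H : ℝ → ℂ} (hH : MemLp H 2)
    (h : ∀ g : 𝓢(ℝ, ℂ), ∫ x, g x * E x = ∫ t, (𝓕⁻ g) t * H t) :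
    E =ᵐ[volume] (𝓕⁻ (hH.toLp H) : Lp (α := ℝ) ℂ 2 volume) := by
  set E2 : Lp (α := ℝ) ℂ 2 volume := 𝓕⁻ (hH.toLp H)
  have key : ∀ g : 𝓢(ℝ, ℂ), ∫ x, g x * E2 x = ∫ t, (𝓕⁻ g) t * H t := by
    intro g
    have h1 := congrArg (fun T : 𝓢'(ℝ, ℂ) => T g)
      (Lp.fourierInv_toTemperedDistribution_eq (hH.toLp H))
    simp only [TemperedDistribution.fourierInv_apply, Lp.toTemperedDistribution_apply,
      smul_eq_mul] at h1
    rw [← h1]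
    refine integral_congr_ae ?_
    filter_upwards [hH.coeFn_toLp] with t ht
    rw [ht]
  refine ae_eq_of_integral_contDiff_smul_eq hE
    ((Lp.memLp E2).locallyIntegrable (by norm_num)) ?_
  intro φ hφ hc
  have hφ' : ContDiff ℝ (⊤ : ℕ∞) (fun x => (φ x : ℂ)) := Complex.ofRealCLM.contDiff.comp hφ
  have hc' : HasCompactSupport (fun x => (φ x : ℂ)) :=
    hc.comp_left (g := fun r : ℝ => (r : ℂ)) (by simp)
  have e1 := (h (hc'.toSchwartzMap hφ')).trans (key (hc'.toSchwartzMap hφ')).symm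
  simpa using e1

open SchwartzMap FourierTransform in
-- `f` is only integrable, so the difference is not known in advance to be square integrable. It is
-- identified with an L² inverse transform by moving the transform onto a Schwartz test function
-- (Fubini); the L² isometry then finishes.
theorem lintegral_enorm_fourierInv_sub_sq {f G : ℝ → ℂ} (hf : Integrable f) (hG : Integrable G)
    (hG2 : MemLp G 2) (hf2 : MemLp (𝓕 f) 2) :
    ∫⁻ x, ‖𝓕⁻ G x - f x‖ₑ ^ 2 = ∫⁻ t, ‖G t - 𝓕 f t‖ₑ ^ 2 := by
  have hH : MemLp (fun t => G t - 𝓕 f t) 2 := hG2.sub hf2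
  have hcont : Continuous (𝓕⁻ G) := by
    have : 𝓕⁻ G = fun w => 𝓕 G (-w) := by
      ext w; rw [Real.fourierInv_eq_fourier_neg]
    rw [this]
    exact (VectorFourier.fourierIntegral_continuous Real.continuous_fourierChar
      (by fun_prop) hG).comp continuous_neg
  have hbdd : ∀ x, ‖𝓕⁻ G x‖ ≤ ∫ t, ‖G t‖ := by
    intro x
    rw [Real.fourierInv_eq_fourier_neg]
    exact VectorFourier.norm_fourierIntegral_le_integral_norm _ _ _ _ _
  have hfc : Continuous (𝓕 f) := VectorFourier.fourierIntegral_continuous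
    Real.continuous_fourierChar (by fun_prop) hf
  have hfb : ∀ x, ‖𝓕 f x‖ ≤ ∫ t, ‖f t‖ := fun x =>
    VectorFourier.norm_fourierIntegral_le_integral_norm _ _ _ _ _
  have hE : LocallyIntegrable (fun x => 𝓕⁻ G x - f x) :=
    hcont.locallyIntegrable.sub hf.locallyIntegrable
  have hae := ae_eq_fourierInv_of_integral_schwartz hE hH (by
    intro g
    have i1 : Integrable (fun x => g x * 𝓕⁻ G x) :=
      g.integrable.mul_bdd hcont.aestronglyMeasurable (Eventually.of_forall hbdd)
    have i2 : Integrable (fun x => g x * f x) := by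
      have := hf.bdd_mul (g.continuous.aestronglyMeasurable (μ := volume))
        (Eventually.of_forall (g.norm_le_seminorm ℂ))
      simpa using this
    have i3 : Integrable (fun t => (𝓕⁻ g) t * G t) :=
      hG.bdd_mul ((𝓕⁻ g).continuous.aestronglyMeasurable (μ := volume))
        (Eventually.of_forall ((𝓕⁻ g).norm_le_seminorm ℂ))
    have i4 : Integrable (fun t => (𝓕⁻ g) t * 𝓕 f t) :=
      (𝓕⁻ g).integrable.mul_bdd hfc.aestronglyMeasurable (Eventually.of_forall hfb)
    simp only [mul_sub]
    rw [integral_sub i1 i2, integral_sub i3 i4]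
    congr 1
    -- Both inverse transforms are written through reflections, so that the multiplication formula
    -- for the forward transform applies.
    · have e1 : 𝓕⁻ G = fun w => 𝓕 G (-w) := by
        ext w; rw [Real.fourierInv_eq_fourier_neg]
      have e2 : ∀ t, (𝓕⁻ g) t = 𝓕 (fun x => g (-x)) t := by
        intro t
        rw [SchwartzMap.fourierInv_coe, Real.fourierInv_eq_fourier_comp_neg]
      have e3 := VectorFourier.integral_fourierIntegral_smul_eq_flip (L := innerₗ ℝ)
        Real.continuous_fourierChar (by fun_prop) (g.integrable.comp_neg (μ := volume)) hG
      rw [e1, ← integral_neg_eq_self]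
      simp only [neg_neg, e2]
      rw [flip_innerₗ] at e3
      exact e3.symm
    · have e3 := VectorFourier.integral_fourierIntegral_smul_eq_flip (L := innerₗ ℝ)
        Real.continuous_fourierChar (by fun_prop) ((𝓕⁻ g).integrable (μ := volume)) hf
      rw [flip_innerₗ] at e3
      have e4 : ∀ x, 𝓕 (𝓕⁻ g : 𝓢(ℝ, ℂ)) x = g x := by intro x; rw [fourier_fourierInv_eq]
      refine Eq.trans ?_ e3
      exact integral_congr_ae (Eventually.of_forall fun x => by
        change g x * f x = 𝓕 (𝓕⁻ g : 𝓢(ℝ, ℂ)) x * f x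
        rw [e4]))
  have sq : ∀ F : ℝ → ℂ, ∫⁻ x, ‖F x‖ₑ ^ 2 = eLpNorm F 2 volume ^ 2 := by
    intro F
    have := eLpNorm_nnreal_pow_eq_lintegral (f := F) (μ := volume) (p := 2) (by norm_num)
    norm_num at this
    exact_mod_cast this.symm
  rw [sq, sq, eLpNorm_congr_ae hae, ← eLpNorm_congr_ae hH.coeFn_toLp, ← Lp.enorm_def,
    ← Lp.enorm_def]
  congr 1
  have := Lp.norm_fourier_eq (𝓕⁻ (hH.toLp _) : Lp (α := ℝ) ℂ 2 volume)
  rw [fourier_fourierInv_eq] at this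
  rw [← ofReal_norm, ← ofReal_norm, this]

end

/-! ### Laws, characteristic functions, and independence of subsamples. -/

noncomputable section

theorem IsProbDensity.isProbabilityMeasure {f : ℝ → ℝ} (hf : IsProbDensity f) :
    IsProbabilityMeasure (densityLaw f) := by
  constructor
  rw [densityLaw, withDensity_apply _ MeasurableSet.univ, Measure.restrict_univ,
    ← ofReal_integral_eq_lintegral_ofReal hf.integrable (Eventually.of_forall hf.nonneg),
    hf.integral_eq_one, ENNReal.ofReal_one]

theorem isProbabilityMeasure_atomLaw {p : ℝ} (h0 : 0 ≤ p) (h1 : p ≤ 1) :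
    IsProbabilityMeasure (atomLaw p) := by
  constructor
  simp [atomLaw, ← ENNReal.ofReal_add h0 (sub_nonneg.2 h1)]

theorem measurable_observation : Measurable (fun ω : ℝ × ℝ × ℝ => ω.1 * ω.2.1 + ω.2.2) := by
  fun_prop

theorem isProbabilityMeasure_observationLaw {p : ℝ} (h0 : 0 ≤ p) (h1 : p ≤ 1) {f k : ℝ → ℝ}
    (hf : IsProbDensity f) (hk : IsProbDensity k) :
    IsProbabilityMeasure (observationLaw p f k) := by
  have := hf.isProbabilityMeasure
  have := hk.isProbabilityMeasure
  have := isProbabilityMeasure_atomLaw h0 h1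
  exact Measure.isProbabilityMeasure_map measurable_observation.aemeasurable

theorem densityCF_apply {f : ℝ → ℝ} (hf : IsProbDensity f) (t : ℝ) :
    densityCF f t = ∫ x : ℝ, Complex.exp (t * x * Complex.I) * f x := by
  rw [densityCF, charFun_apply_real, densityLaw,
    integral_withDensity_eq_integral_toReal_smul₀ hf.integrable.1.aemeasurable.ennreal_ofReal
      (Eventually.of_forall fun _ => ENNReal.ofReal_lt_top)]
  refine integral_congr_ae (Eventually.of_forall fun x => ?_)
  simp only [ENNReal.toReal_ofReal (hf.nonneg x), Complex.real_smul]
  ring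

/-- The Fourier transform of the library has kernel `exp (-2πi s x)`, hence the dilation by `-2π`
here and below. -/
theorem densityCF_eq_fourier {f : ℝ → ℝ} (hf : IsProbDensity f) (s : ℝ) :
    densityCF f (s * (-(2 * Real.pi))) = FourierTransform.fourier (fun x => (f x : ℂ)) s := by
  rw [densityCF_apply hf, Real.fourier_real_eq_integral_exp_smul]
  refine integral_congr_ae (Eventually.of_forall fun x => ?_)
  simp only [smul_eq_mul]
  congr 2
  push_cast
  ring

theorem norm_densityCF_le_one {f : ℝ → ℝ} (hf : IsProbDensity f) (t : ℝ) :
    ‖densityCF f t‖ ≤ 1 := by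
  have := hf.isProbabilityMeasure
  exact norm_charFun_le_one t

theorem continuous_densityCF {f : ℝ → ℝ} (hf : IsProbDensity f) : Continuous (densityCF f) := by
  have := hf.isProbabilityMeasure
  exact continuous_charFun

/-- Conditioning on `A` leaves `φ_f(tA) φ_Z(t)`, and `φ_f(0) = 1` produces the atom. Dividing by
`φ_Z` leaves `p + (1 - p) φ_f`, on which both estimators rest. -/
theorem charFun_observationLaw {p : ℝ} (h0 : 0 ≤ p) (h1 : p ≤ 1) {f k : ℝ → ℝ}
    (hf : IsProbDensity f) (hk : IsProbDensity k) (t : ℝ) :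
    charFun (observationLaw p f k) t = (p + (1 - p) * densityCF f t) * densityCF k t := by
  have := hf.isProbabilityMeasure
  have := hk.isProbabilityMeasure
  have := isProbabilityMeasure_atomLaw h0 h1
  have inner : ∀ a : ℝ, ∫ y : ℝ × ℝ, Complex.exp (t * (a * y.1 + y.2) * Complex.I)
      ∂((densityLaw f).prod (densityLaw k)) = densityCF f (t * a) * densityCF k t := by
    intro a
    rw [densityCF, densityCF, charFun_apply_real, charFun_apply_real, ← integral_prod_mul]
    refine integral_congr_ae (Eventually.of_forall fun y => ?_)
    simp only [← Complex.exp_add]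
    congr 1
    push_cast
    ring
  have hint : Integrable (fun ω : ℝ × ℝ × ℝ =>
      Complex.exp (t * (ω.1 * ω.2.1 + ω.2.2) * Complex.I))
      ((atomLaw p).prod ((densityLaw f).prod (densityLaw k))) := by
    refine Integrable.of_bound (by fun_prop) 1 (Eventually.of_forall fun ω => ?_)
    have := Complex.norm_exp_ofReal_mul_I (t * (ω.1 * ω.2.1 + ω.2.2))
    push_cast at this
    exact this.le
  rw [charFun_apply_real, observationLaw, integral_map measurable_observation.aemeasurable
    (by fun_prop)]
  push_cast
  rw [integral_prod _ hint]
  simp only [inner]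
  have hc : Continuous (fun a : ℝ => densityCF f (t * a) * densityCF k t) :=
    ((continuous_densityCF hf).comp (by fun_prop)).mul continuous_const
  rw [atomLaw, integral_add_measure, integral_smul_measure, integral_smul_measure,
    integral_dirac, integral_dirac, ENNReal.toReal_ofReal h0,
    ENNReal.toReal_ofReal (sub_nonneg.2 h1)]
  · have e0 : densityCF f 0 = 1 := by simp [densityCF]
    simp only [mul_zero, mul_one, e0, Complex.real_smul]
    push_cast
    ring
  · exact (integrable_dirac (by simp [ENNReal.mul_lt_top])).smul_measure ENNReal.ofReal_ne_top
  · exact (integrable_dirac (by simp [ENNReal.mul_lt_top])).smul_measure ENNReal.ofReal_ne_top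

/-- Extension by zero of a tuple indexed by the finite set `s`. -/
def extendZero {n : ℕ} (s : Finset (Fin n)) (y : s → ℝ) : Fin n → ℝ :=
  fun j => if h : j ∈ s then y ⟨j, h⟩ else 0

theorem measurable_extendZero {n : ℕ} (s : Finset (Fin n)) : Measurable (extendZero s) := by
  refine measurable_pi_lambda _ fun j => ?_
  by_cases h : j ∈ s
  · simp only [extendZero, h, dite_true]; fun_prop
  · simp only [extendZero, h, dite_false]; fun_prop

/-- Expresses that the empirical characteristic function over `s` depends only on the coordinates in
`s`, in the form required by `lintegral_mul_of_disjoint`. -/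
theorem empCF_extendZero {n : ℕ} (s : Finset (Fin n)) (X : Fin n → ℝ) :
    empCF (extendZero s (fun j : s => X j)) s = empCF X s := by
  ext t
  rw [empCF, empCF]
  congr 1
  refine Finset.sum_congr rfl fun j hj => ?_
  simp [extendZero, hj]

/-- Under a product measure, functionals of disjoint sets of coordinates are independent. -/
theorem lintegral_mul_of_disjoint {n : ℕ} (μ : Measure ℝ) [IsProbabilityMeasure μ]
    {s s' : Finset (Fin n)} (hs : Disjoint s s') {F G : (Fin n → ℝ) → ℝ≥0∞}
    (hF : Measurable F) (hG : Measurable G)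
    (hFs : ∀ X, F (extendZero s (fun j : s => X j)) = F X)
    (hGs : ∀ X, G (extendZero s' (fun j : s' => X j)) = G X) :
    ∫⁻ X, F X * G X ∂(Measure.pi fun _ : Fin n => μ) =
      (∫⁻ X, F X ∂(Measure.pi fun _ : Fin n => μ)) *
        ∫⁻ X, G X ∂(Measure.pi fun _ : Fin n => μ) := by
  have hind : ProbabilityTheory.iIndepFun (fun (i : Fin n) (X : Fin n → ℝ) => X i)
      (Measure.pi fun _ : Fin n => μ) :=
    ProbabilityTheory.iIndepFun_pi (X := fun _ x => x) (fun _ => aemeasurable_id)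
  have h2 := hind.indepFun_finset s s' hs (fun i => measurable_pi_apply i)
  have h3 := h2.comp (hF.comp (measurable_extendZero s)) (hG.comp (measurable_extendZero s'))
  -- By `hFs` and `hGs` the two functionals factor through restrictions to `s` and `s'`.
  have e1 : (F ∘ extendZero s) ∘ (fun (X : Fin n → ℝ) (j : s) => X j) = F := funext hFs
  have e2 : (G ∘ extendZero s') ∘ (fun (X : Fin n → ℝ) (j : s') => X j) = G := funext hGs
  rw [e1, e2] at h3
  exact ProbabilityTheory.lintegral_mul_eq_lintegral_mul_lintegral_of_indepFun hF hG h3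

end

/-! ### Variance of empirical averages and of the empirical characteristic function. -/

noncomputable section

open ProbabilityTheory in
theorem integral_sq_average_sub_le {n : ℕ} (μ : Measure ℝ) [IsProbabilityMeasure μ]
    {s : Finset (Fin n)} (hs : s.Nonempty) {G : ℝ → ℝ} (hG : Measurable G) {M : ℝ}
    (hM : ∀ x, |G x| ≤ M) :
    ∫ X, ((s.card : ℝ)⁻¹ * ∑ j ∈ s, G (X j) - ∫ x, G x ∂μ) ^ 2
      ∂(Measure.pi fun _ : Fin n => μ) ≤ (s.card : ℝ)⁻¹ * ∫ x, G x ^ 2 ∂μ := by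
  set P := Measure.pi fun _ : Fin n => μ
  have hc : (0 : ℝ) < s.card := by exact_mod_cast hs.card_pos
  have hmp : ∀ j : Fin n, MeasurePreserving (fun X : Fin n → ℝ => X j) P μ := fun j =>
    measurePreserving_eval (fun _ : Fin n => μ) j
  have hGL : MemLp G 2 μ := MemLp.of_bound hG.aestronglyMeasurable M (Eventually.of_forall hM)
  have hL : ∀ j : Fin n, MemLp (fun X : Fin n → ℝ => G (X j)) 2 P := fun j =>
    hGL.comp_measurePreserving (hmp j)
  have hvar : ∀ j : Fin n, Var[fun X : Fin n → ℝ => G (X j); P] = Var[G; μ] := fun j =>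
    (hmp j).variance_fun_comp hG.aemeasurable
  have hmean : ∀ j : Fin n, ∫ X : Fin n → ℝ, G (X j) ∂P = ∫ x, G x ∂μ := by
    intro j
    rw [← (hmp j).map_eq, integral_map (measurable_pi_apply j).aemeasurable
      hG.aestronglyMeasurable]
  have hind : iIndepFun (fun (i : Fin n) (X : Fin n → ℝ) => G (X i)) P :=
    iIndepFun_pi (X := fun _ x => G x) (fun _ => hG.aemeasurable)
  have hsum := IndepFun.variance_sum (s := s) (fun i _ => hL i)
    (fun i _ j _ hij => hind.indepFun hij)
  have hmeanavg : ∫ X, (s.card : ℝ)⁻¹ * (∑ j ∈ s, fun X : Fin n → ℝ => G (X j)) X ∂P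
      = ∫ x, G x ∂μ := by
    rw [integral_const_mul]
    simp only [Finset.sum_apply]
    rw [integral_finsetSum _ fun j _ => (hL j).integrable (by norm_num)]
    simp only [hmean, Finset.sum_const, nsmul_eq_mul]
    field_simp
  have h1 := variance_const_mul (s.card : ℝ)⁻¹ (∑ j ∈ s, fun X : Fin n → ℝ => G (X j)) P
  rw [variance_eq_integral (by fun_prop), hmeanavg, hsum] at h1
  simp only [Finset.sum_apply, hvar, Finset.sum_const, nsmul_eq_mul] at h1
  rw [h1]
  have h2 := variance_le_expectation_sq (μ := μ) (X := G) hG.aestronglyMeasurable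
  simp only [Pi.pow_apply] at h2
  calc (s.card : ℝ)⁻¹ ^ 2 * (s.card * Var[G; μ]) = (s.card : ℝ)⁻¹ * Var[G; μ] := by
        field_simp
    _ ≤ _ := by gcongr

theorem abs_average_le {n : ℕ} (s : Finset (Fin n)) {G : ℝ → ℝ} {M : ℝ}
    (hM : ∀ x, |G x| ≤ M) (X : Fin n → ℝ) :
    |(s.card : ℝ)⁻¹ * ∑ j ∈ s, G (X j)| ≤ M := by
  have hM0 : 0 ≤ M := (abs_nonneg _).trans (hM 0)
  rw [abs_mul, abs_inv, Nat.abs_cast]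
  have : |∑ j ∈ s, G (X j)| ≤ s.card * M := by
    refine (Finset.abs_sum_le_sum_abs _ _).trans ?_
    calc ∑ j ∈ s, |G (X j)| ≤ ∑ j ∈ s, M := Finset.sum_le_sum fun j _ => hM _
      _ = _ := by simp
  calc (s.card : ℝ)⁻¹ * |∑ j ∈ s, G (X j)| ≤ (s.card : ℝ)⁻¹ * (s.card * M) := by gcongr
    _ ≤ M := by
      rw [← mul_assoc]
      exact mul_le_of_le_one_left hM0 inv_mul_le_one

theorem lintegral_sq_average_sub_le {n : ℕ} (μ : Measure ℝ) [IsProbabilityMeasure μ]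
    {s : Finset (Fin n)} (hs : s.Nonempty) {G : ℝ → ℝ} (hG : Measurable G) {M : ℝ}
    (hM : ∀ x, |G x| ≤ M) :
    ∫⁻ X, ENNReal.ofReal (((s.card : ℝ)⁻¹ * ∑ j ∈ s, G (X j) - ∫ x, G x ∂μ) ^ 2)
      ∂(Measure.pi fun _ : Fin n => μ) ≤ ENNReal.ofReal ((s.card : ℝ)⁻¹ * ∫ x, G x ^ 2 ∂μ) := by
  rw [← ofReal_integral_eq_lintegral_ofReal]
  · exact ENNReal.ofReal_le_ofReal (integral_sq_average_sub_le μ hs hG hM)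
  · refine Integrable.of_bound (Measurable.aestronglyMeasurable (by fun_prop))
      ((M + |∫ x, G x ∂μ|) ^ 2)
      (Eventually.of_forall fun X => ?_)
    rw [Real.norm_eq_abs, abs_pow]
    gcongr
    exact (abs_sub _ _).trans (by gcongr; exact abs_average_le s hM X)
  · exact Eventually.of_forall fun X => sq_nonneg _

theorem continuous_empCF {n : ℕ} (s : Finset (Fin n)) :
    Continuous (fun z : (Fin n → ℝ) × ℝ => empCF z.1 s z.2) := by
  unfold empCF
  fun_prop

/-- Real and imaginary parts are averages of `cos (t X)` and `sin (t X)`; bounding each variance by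
a second moment, `cos² + sin² = 1` gives the constant 1. -/
theorem lintegral_enorm_empCF_sub_sq_le {n : ℕ} (μ : Measure ℝ) [IsProbabilityMeasure μ]
    {s : Finset (Fin n)} (hs : s.Nonempty) (t : ℝ) :
    ∫⁻ X, ‖empCF X s t - charFun μ t‖ₑ ^ 2 ∂(Measure.pi fun _ : Fin n => μ)
      ≤ ENNReal.ofReal (s.card : ℝ)⁻¹ := by
  have hcos := lintegral_sq_average_sub_le μ hs (G := fun x => Real.cos (t * x)) (by fun_prop)
    (fun x => Real.abs_cos_le_one _)
  have hsin := lintegral_sq_average_sub_le μ hs (G := fun x => Real.sin (t * x)) (by fun_prop)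
    (fun x => Real.abs_sin_le_one _)
  have hexp : ∀ x : ℝ, Complex.exp (t * x * Complex.I)
      = (Real.cos (t * x) : ℂ) + (Real.sin (t * x) : ℂ) * Complex.I := by
    intro x
    rw [Complex.exp_mul_I]
    push_cast
    rfl
  have ic : Integrable (fun x => Real.cos (t * x)) μ :=
    Integrable.of_bound (by fun_prop) 1 (Eventually.of_forall fun x => Real.abs_cos_le_one _)
  have is : Integrable (fun x => Real.sin (t * x)) μ :=
    Integrable.of_bound (by fun_prop) 1 (Eventually.of_forall fun x => Real.abs_sin_le_one _)
  have hcf : charFun μ t = (∫ x, Real.cos (t * x) ∂μ : ℝ) + (∫ x, Real.sin (t * x) ∂μ : ℝ) *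
      Complex.I := by
    rw [charFun_apply_real]
    simp only [hexp]
    rw [integral_add ic.ofReal (is.ofReal.mul_const _), integral_mul_const, integral_complex_ofReal,
      integral_complex_ofReal]
  have hpt : ∀ X : Fin n → ℝ, ‖empCF X s t - charFun μ t‖ₑ ^ 2 =
      ENNReal.ofReal (((s.card : ℝ)⁻¹ * ∑ j ∈ s, Real.cos (t * X j)
        - ∫ x, Real.cos (t * x) ∂μ) ^ 2) +
      ENNReal.ofReal (((s.card : ℝ)⁻¹ * ∑ j ∈ s, Real.sin (t * X j)
        - ∫ x, Real.sin (t * x) ∂μ) ^ 2) := by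
    intro X
    have he : empCF X s t - charFun μ t =
      ((s.card : ℝ)⁻¹ * ∑ j ∈ s, Real.cos (t * X j) - ∫ x, Real.cos (t * x) ∂μ : ℝ) +
      ((s.card : ℝ)⁻¹ * ∑ j ∈ s, Real.sin (t * X j) - ∫ x, Real.sin (t * x) ∂μ : ℝ) *
        Complex.I := by
      have : ∀ x : ℝ, Complex.exp (Complex.I * t * x) = Complex.exp (t * x * Complex.I) := by
        intro x; congr 1; ring
      rw [hcf, empCF]
      simp only [this, hexp, Finset.sum_add_distrib, ← Finset.sum_mul]
      push_cast
      ring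
    rw [he, ← ENNReal.ofReal_add (sq_nonneg _) (sq_nonneg _), ← ofReal_norm,
      ← ENNReal.ofReal_pow (norm_nonneg _), Complex.sq_norm, Complex.normSq_add_mul_I]
  simp only [hpt]
  rw [lintegral_add_left (by fun_prop)]
  refine (add_le_add hcos hsin).trans ?_
  rw [← ENNReal.ofReal_add (by positivity) (by positivity), ← mul_add, ← integral_add]
  · simp
  · exact Integrable.of_bound (by fun_prop) 1 (Eventually.of_forall fun x => by
      rw [Real.norm_eq_abs, abs_pow]; exact pow_le_one₀ (abs_nonneg _) (Real.abs_cos_le_one _))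
  · exact Integrable.of_bound (by fun_prop) 1 (Eventually.of_forall fun x => by
      rw [Real.norm_eq_abs, abs_pow]; exact pow_le_one₀ (abs_nonneg _) (Real.abs_sin_le_one _))

end

/-! ### Second moments of Fourier integrals evaluated at a random point. -/

noncomputable section

theorem norm_exp_I_mul (t x : ℝ) : ‖Complex.exp (Complex.I * t * x)‖ = 1 := by
  rw [mul_assoc, mul_comm, ← Complex.ofReal_mul, Complex.norm_exp_ofReal_mul_I]

/-- The integral `∫ exp (i t x) ψ t dt`. -/
def charIntegral (ψ : ℝ → ℂ) (x : ℝ) : ℂ := ∫ t : ℝ, Complex.exp (Complex.I * t * x) * ψ t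

theorem continuous_charIntegral {ψ : ℝ → ℂ} (hψ : Integrable ψ) :
    Continuous (charIntegral ψ) := by
  refine continuous_of_dominated (bound := fun t => ‖ψ t‖) (fun x => ?_) (fun x => ?_) hψ.norm ?_
  · exact (Continuous.aestronglyMeasurable (by fun_prop)).mul hψ.1
  · exact Eventually.of_forall fun t => by rw [norm_mul, norm_exp_I_mul, one_mul]
  · exact Eventually.of_forall fun t => by fun_prop

theorem norm_charIntegral_le (ψ : ℝ → ℂ) (x : ℝ) :
    ‖charIntegral ψ x‖ ≤ ∫ t, ‖ψ t‖ := by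
  refine (norm_integral_le_integral_norm _).trans_eq ?_
  simp only [norm_mul, norm_exp_I_mul, one_mul]

/-- Fubini with a bounded weight `F`, later taken to be 1, a conjugated exponential, and the
conjugate of the integral itself. -/
theorem integral_charIntegral_mul (μ : Measure ℝ) [IsProbabilityMeasure μ] {ψ : ℝ → ℂ}
    (hψ : Integrable ψ) {F : ℝ → ℂ} (hF : Measurable F) {M : ℝ} (hM : ∀ x, ‖F x‖ ≤ M) :
    ∫ x, charIntegral ψ x * F x ∂μ =
      ∫ t, ψ t * ∫ x, Complex.exp (Complex.I * t * x) * F x ∂μ := by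
  simp only [charIntegral, ← integral_mul_const, ← integral_const_mul]
  rw [integral_integral_swap]
  · refine integral_congr_ae (Eventually.of_forall fun t => ?_)
    refine integral_congr_ae (Eventually.of_forall fun x => ?_)
    ring
  · have h1 : Integrable (fun z : ℝ × ℝ => F z.1 * ψ z.2) (μ.prod volume) :=
      (Integrable.of_bound hF.aestronglyMeasurable M (Eventually.of_forall hM)).mul_prod hψ
    refine h1.mono ?_ (Eventually.of_forall fun z => ?_)
    · refine AEStronglyMeasurable.mul ?_ (hF.comp measurable_fst).aestronglyMeasurable
      exact (Continuous.aestronglyMeasurable (by fun_prop)).mul hψ.1.comp_snd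
    · simp only [Function.uncurry, norm_mul, norm_exp_I_mul, one_mul]
      exact (mul_comm _ _).le

theorem charFun_eq_integral_exp (μ : Measure ℝ) (t : ℝ) :
    charFun μ t = ∫ x : ℝ, Complex.exp (Complex.I * t * x) ∂μ := by
  rw [charFun_apply_real]
  refine integral_congr_ae (Eventually.of_forall fun x => ?_)
  simp only
  congr 1
  ring

theorem integral_charIntegral (μ : Measure ℝ) [IsProbabilityMeasure μ] {ψ : ℝ → ℂ}
    (hψ : Integrable ψ) : ∫ x, charIntegral ψ x ∂μ = ∫ t, ψ t * charFun μ t := by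
  have := integral_charIntegral_mul μ hψ (F := fun _ => 1) measurable_const (M := 1) (by simp)
  simpa only [mul_one, charFun_eq_integral_exp] using this

theorem ennreal_mul_le_sq_add_sq (a b : ℝ≥0∞) : a * b ≤ a ^ 2 + b ^ 2 := by
  rcases le_total a b with h | h
  · calc a * b ≤ b * b := by gcongr
      _ ≤ _ := by rw [sq b]; exact le_add_self
  · calc a * b ≤ a * a := by gcongr
      _ ≤ _ := by rw [sq a]; exact le_self_add

/-- Schur-type bound: if the characteristic function is dominated by `χ`, then
`E |∫ exp (i t X) ψ t dt|² ≤ 2 ‖ψ‖₂² ‖χ‖₁`. -/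
theorem integral_normSq_charIntegral_le (μ : Measure ℝ) [IsProbabilityMeasure μ] {ψ : ℝ → ℂ}
    (hψ : Integrable ψ) {χ : ℝ → ℂ} (hχ : Measurable χ) (hd : ∀ t, ‖charFun μ t‖ ≤ ‖χ t‖) :
    ENNReal.ofReal (∫ x, ‖charIntegral ψ x‖ ^ 2 ∂μ) ≤
      2 * (∫⁻ t, ‖ψ t‖ₑ ^ 2) * ∫⁻ t, ‖χ t‖ₑ := by
  have hcont := continuous_charIntegral hψ
  have hinner : ∀ t : ℝ, ∫ x, Complex.exp (Complex.I * t * x) *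
      (starRingEnd ℂ) (charIntegral ψ x) ∂μ =
      ∫ s, (starRingEnd ℂ) (ψ s) * charFun μ (t - s) := by
    intro t
    have h1 := integral_charIntegral_mul μ hψ
      (F := fun x => (starRingEnd ℂ) (Complex.exp (Complex.I * t * x))) (by fun_prop) (M := 1)
      (fun x => by rw [RCLike.norm_conj, norm_exp_I_mul])
    have h2 := congrArg (starRingEnd ℂ) h1
    rw [← integral_conj, ← integral_conj] at h2
    simp only [map_mul, Complex.conj_conj, ← integral_conj] at h2
    simp only [mul_comm (Complex.exp _) ((starRingEnd ℂ) (charIntegral ψ _)), h2,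
      charFun_eq_integral_exp]
    refine integral_congr_ae (Eventually.of_forall fun s => ?_)
    simp only
    congr 1
    refine integral_congr_ae (Eventually.of_forall fun x => ?_)
    simp only [← Complex.exp_conj, map_mul, Complex.conj_I, Complex.conj_ofReal,
      ← Complex.exp_add]
    congr 1
    push_cast
    ring
  -- The second moment is the quadratic form of `ψ` with convolution kernel `φ_μ(t - s)`.
  have h0 : (∫ x, ‖charIntegral ψ x‖ ^ 2 ∂μ : ℝ) =
      ‖∫ t, ψ t * ∫ s, (starRingEnd ℂ) (ψ s) * charFun μ (t - s)‖ := by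
    have h3 := integral_charIntegral_mul μ hψ
      (F := fun x => (starRingEnd ℂ) (charIntegral ψ x))
      (Complex.continuous_conj.comp hcont).measurable (M := ∫ t, ‖ψ t‖)
      (fun x => by rw [RCLike.norm_conj]; exact norm_charIntegral_le ψ x)
    simp only [hinner] at h3
    rw [← h3]
    simp only [Complex.mul_conj, Complex.normSq_eq_norm_sq]
    rw [integral_complex_ofReal, Complex.norm_real, Real.norm_eq_abs, abs_of_nonneg]
    exact integral_nonneg fun x => sq_nonneg _
  rw [h0, ofReal_norm]
  have hψm : AEMeasurable (fun t => ‖ψ t‖ₑ ^ 2) := hψ.1.enorm.pow_const 2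
  calc ‖∫ t, ψ t * ∫ s, (starRingEnd ℂ) (ψ s) * charFun μ (t - s)‖ₑ
      ≤ ∫⁻ t, ‖ψ t‖ₑ * ∫⁻ s, ‖ψ s‖ₑ * ‖χ (t - s)‖ₑ := by
        refine (enorm_integral_le_lintegral_enorm _).trans (lintegral_mono fun t => ?_)
        rw [enorm_mul]
        gcongr
        refine (enorm_integral_le_lintegral_enorm _).trans (lintegral_mono fun s => ?_)
        rw [enorm_mul, RCLike.enorm_conj]
        gcongr
        exact enorm_le_iff_norm_le.2 (hd _)
    -- After `ab ≤ a² + b²`, translation invariance integrates out the other variable in each half,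
    -- leaving `‖χ‖₁`; the two halves give the factor 2.
    _ ≤ ∫⁻ t, ∫⁻ s, (‖ψ t‖ₑ ^ 2 * ‖χ (t - s)‖ₑ + ‖ψ s‖ₑ ^ 2 * ‖χ (t - s)‖ₑ) := by
        refine lintegral_mono fun t => ?_
        rw [← lintegral_const_mul' _ _ enorm_ne_top]
        refine lintegral_mono fun s => ?_
        rw [← mul_assoc, ← add_mul]
        gcongr
        exact ennreal_mul_le_sq_add_sq _ _
    _ = ∫⁻ t, (‖ψ t‖ₑ ^ 2 * (∫⁻ s, ‖χ s‖ₑ) + ∫⁻ s, ‖ψ s‖ₑ ^ 2 * ‖χ (t - s)‖ₑ) := by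
        refine lintegral_congr fun t => ?_
        rw [lintegral_add_left (by fun_prop), lintegral_const_mul _ (by fun_prop),
          lintegral_sub_left_eq_self (fun s => ‖χ s‖ₑ)]
    _ = (∫⁻ t, ‖ψ t‖ₑ ^ 2) * (∫⁻ s, ‖χ s‖ₑ) +
          ∫⁻ t, ∫⁻ s, ‖ψ s‖ₑ ^ 2 * ‖χ (t - s)‖ₑ := by
        rw [lintegral_add_left' (hψm.mul_const _), lintegral_mul_const'' _ hψm]
    _ = (∫⁻ t, ‖ψ t‖ₑ ^ 2) * (∫⁻ s, ‖χ s‖ₑ) + (∫⁻ t, ‖ψ t‖ₑ ^ 2) * (∫⁻ s, ‖χ s‖ₑ) := by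
        congr 1
        rw [lintegral_lintegral_swap]
        · rw [← lintegral_mul_const'' _ hψm]
          refine lintegral_congr fun s => ?_
          rw [lintegral_const_mul _ (by fun_prop), lintegral_sub_right_eq_self (fun s => ‖χ s‖ₑ)]
        · exact (hψm.comp_snd).mul (Measurable.aemeasurable (by fun_prop))
    _ = _ := by ring

end

/-! ### Bias and variance of the estimator of the atom. -/

noncomputable section

theorem sq_lintegral_le {X : Type*} [MeasurableSpace X] (μ : Measure X) {F : X → ℝ≥0∞}
    (hF : AEMeasurable F μ) : (∫⁻ x, F x ∂μ) ^ 2 ≤ μ Set.univ * ∫⁻ x, F x ^ 2 ∂μ := by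
  have h := ENNReal.lintegral_mul_le_Lp_mul_Lq μ Real.HolderConjugate.two_two hF
    (aemeasurable_const (b := (1 : ℝ≥0∞)))
  simp only [Pi.mul_apply, mul_one, ENNReal.one_rpow, lintegral_one] at h
  calc (∫⁻ x, F x ∂μ) ^ 2
      ≤ ((∫⁻ x, F x ^ (2 : ℝ) ∂μ) ^ ((1 : ℝ) / 2) * μ Set.univ ^ ((1 : ℝ) / 2)) ^ 2 := by gcongr
    _ = μ Set.univ * ∫⁻ x, F x ^ 2 ∂μ := by
      rw [mul_pow, ← ENNReal.rpow_two, ← ENNReal.rpow_two, ← ENNReal.rpow_mul,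
        ← ENNReal.rpow_mul]
      norm_num
      rw [mul_comm]

/-- The window on which `φ_u (g t)` is supported, up to an end point. -/
def window (g : ℝ) : Set ℝ := Set.Ioc (-1 / g) (1 / g)

theorem measurableSet_window (g : ℝ) : MeasurableSet (window g) := measurableSet_Ioc

theorem volume_window {g : ℝ} : volume (window g) = ENNReal.ofReal (2 / g) := by
  rw [window, Real.volume_Ioc]
  congr 1
  ring

theorem abs_mul_le_one_of_mem_window {g : ℝ} (hg : 0 < g) {t : ℝ} (ht : t ∈ window g) :
    |g * t| ≤ 1 := by
  obtain ⟨h1, h2⟩ := ht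
  rw [abs_le]
  rw [div_lt_iff₀ hg] at h1
  rw [le_div_iff₀ hg] at h2
  constructor <;> nlinarith

theorem abs_le_of_mem_window {g : ℝ} {t : ℝ} (ht : t ∈ window g) :
    |t| ≤ 1 / g := by
  obtain ⟨h1, h2⟩ := ht
  rw [neg_div] at h1
  exact abs_le.2 ⟨h1.le, h2⟩

/-- The integrand `φ_u (g t) / φ_Z t` on the window. -/
def atomWeight (φZ : ℝ → ℂ) (φu : ℝ → ℝ) (g : ℝ) : ℝ → ℂ :=
  (window g).indicator fun t => (φu (g * t) : ℂ) / φZ t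

/-- The contribution of a single observation to the estimator of the atom. -/
def atomScore (φZ : ℝ → ℂ) (φu : ℝ → ℝ) (g x : ℝ) : ℝ :=
  g / 2 * (charIntegral (atomWeight φZ φu g) x).re

variable {α K p g R U : ℝ} {f k φu : ℝ → ℝ}

theorem integrable_atomWeight (hk : IsProbDensity k) (hne : ∀ t, densityCF k t ≠ 0)
    (hu : IsAtomKernelFT φu α) (hg : 0 < g) :
    Integrable (atomWeight (densityCF k) φu g) := by
  rw [atomWeight, integrable_indicator_iff (measurableSet_window g)]
  have h1 : IntegrableOn (fun t => (φu (g * t) : ℂ)) (Set.Icc (-1 / g) (1 / g)) :=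
    ((hu.integrable.comp_mul_left' hg.ne').ofReal).integrableOn
  have h2 := h1.mul_continuousOn
    ((continuous_densityCF hk).continuousOn.inv₀ fun t _ => hne t) isCompact_Icc
  exact (h2.mono_set Set.Ioc_subset_Icc_self)

/-- The estimator is linear in the empirical characteristic function, hence an average of i.i.d.
scores to which the variance bound applies. -/
theorem atomEstimator_empCF (hk : IsProbDensity k) (hne : ∀ t, densityCF k t ≠ 0)
    (hu : IsAtomKernelFT φu α) (hg : 0 < g) {n : ℕ} (s : Finset (Fin n)) (X : Fin n → ℝ) :
    atomEstimator (densityCF k) φu g (empCF X s) =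
      (s.card : ℝ)⁻¹ * ∑ j ∈ s, atomScore (densityCF k) φu g (X j) := by
  have hi := integrable_atomWeight hk hne hu hg
  have hle : -1 / g ≤ 1 / g := by gcongr; norm_num
  have h1 : atomEstimatorC (densityCF k) φu g (empCF X s) = (((s.card : ℝ)⁻¹ * (g / 2) : ℝ) : ℂ) *
      ∑ j ∈ s, charIntegral (atomWeight (densityCF k) φu g) (X j) := by
    have h2 : ∀ t, (window g).indicator
        (fun t => empCF X s t * (φu (g * t) : ℂ) / densityCF k t) t = (s.card : ℂ)⁻¹ *
        ∑ j ∈ s, Complex.exp (Complex.I * t * X j) * atomWeight (densityCF k) φu g t := by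
      intro t
      by_cases ht : t ∈ window g
      · rw [atomWeight, Set.indicator_of_mem ht, Set.indicator_of_mem ht, empCF,
          ← Finset.sum_mul]
        ring
      · simp [atomWeight, Set.indicator_of_notMem ht]
    have hint : ∀ x : ℝ, Integrable fun t : ℝ =>
        Complex.exp (Complex.I * t * x) * atomWeight (densityCF k) φu g t := fun x =>
      hi.bdd_mul (c := 1) (Continuous.aestronglyMeasurable (by fun_prop))
        (Eventually.of_forall fun t => (norm_exp_I_mul t x).le)
    rw [atomEstimatorC, intervalIntegral.integral_of_le hle]
    change _ * ∫ t in window g, _ = _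
    rw [← integral_indicator (measurableSet_window g)]
    simp only [h2]
    rw [integral_const_mul, integral_finsetSum _ fun j _ => hint _]
    simp only [charIntegral]
    push_cast
    ring
  rw [atomEstimator, h1, Complex.re_ofReal_mul, Complex.re_sum, mul_assoc, Finset.mul_sum]
  rfl

theorem continuous_atomScore (hk : IsProbDensity k) (hne : ∀ t, densityCF k t ≠ 0)
    (hu : IsAtomKernelFT φu α) (hg : 0 < g) : Continuous (atomScore (densityCF k) φu g) := by
  unfold atomScore
  exact continuous_const.mul (Complex.continuous_re.comp
    (continuous_charIntegral (integrable_atomWeight hk hne hu hg)))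

theorem abs_atomScore_le (φZ : ℝ → ℂ) (φu : ℝ → ℝ) (hg : 0 < g) (x : ℝ) :
    |atomScore φZ φu g x| ≤ g / 2 * ∫ t, ‖atomWeight φZ φu g t‖ := by
  rw [atomScore, abs_mul, abs_of_pos (by positivity : 0 < g / 2)]
  gcongr
  exact (Complex.abs_re_le_norm _).trans (norm_charIntegral_le _ x)

theorem measurable_atomEstimator (hk : IsProbDensity k) (hne : ∀ t, densityCF k t ≠ 0)
    (hu : IsAtomKernelFT φu α) (hg : 0 < g) {n : ℕ} (s : Finset (Fin n)) :
    Measurable fun X : Fin n → ℝ => atomEstimator (densityCF k) φu g (empCF X s) := by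
  simp only [atomEstimator_empCF hk hne hu hg]
  have := (continuous_atomScore hk hne hu hg).measurable
  fun_prop

theorem norm_charFun_observationLaw_le (h0 : 0 ≤ p) (h1 : p ≤ 1) (hf : IsProbDensity f)
    (hk : IsProbDensity k) (t : ℝ) :
    ‖charFun (observationLaw p f k) t‖ ≤ ‖densityCF k t‖ := by
  rw [charFun_observationLaw h0 h1 hf hk, norm_mul]
  refine mul_le_of_le_one_left (norm_nonneg _) ((norm_add_le _ _).trans ?_)
  rw [norm_mul, Complex.norm_real, Real.norm_of_nonneg h0, ← Complex.ofReal_one,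
    ← Complex.ofReal_sub, Complex.norm_real, Real.norm_of_nonneg (sub_nonneg.2 h1)]
  nlinarith [norm_densityCF_le_one hf t]

/-- The Schur-type bound applies with `χ = φ_Z`: the weight has squared L² norm at most `U² R ·
2/g`, which with the prefactor `(g/2)²` leaves one factor `g`. Bounding the score by its supremum
would lose that factor. -/
theorem integral_atomScore_sq_le (h0 : 0 ≤ p) (h1 : p ≤ 1) (hf : IsProbDensity f)
    (hk : IsProbDensity k) (hne : ∀ t, densityCF k t ≠ 0) (hint : Integrable (densityCF k))
    (hα : 0 < α) (hu : IsAtomKernelFT φu α) (hg : 0 < g) (hU : ∀ t, |φu t| ≤ U * |t| ^ α)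
    (hR : ∀ t, |t| ≤ 1 / g → (‖densityCF k t‖⁻¹) ^ 2 ≤ R) :
    ∫ x, atomScore (densityCF k) φu g x ^ 2 ∂(observationLaw p f k) ≤
      g * U ^ 2 * R * ∫ t, ‖densityCF k t‖ := by
  have := isProbabilityMeasure_observationLaw h0 h1 hf hk
  have hi := integrable_atomWeight hk hne hu hg
  have hR0 : 0 ≤ R := (sq_nonneg _).trans (hR 0 (by simp; positivity))
  have hweight : ∫⁻ t, ‖atomWeight (densityCF k) φu g t‖ₑ ^ 2 ≤
      ENNReal.ofReal (U ^ 2 * R * (2 / g)) := by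
    calc ∫⁻ t, ‖atomWeight (densityCF k) φu g t‖ₑ ^ 2
        ≤ ∫⁻ t, (window g).indicator (fun _ => ENNReal.ofReal (U ^ 2 * R)) t := by
          refine lintegral_mono fun t => ?_
          by_cases ht : t ∈ window g
          · rw [atomWeight, Set.indicator_of_mem ht, Set.indicator_of_mem ht, ← ofReal_norm,
              ← ENNReal.ofReal_pow (norm_nonneg _)]
            refine ENNReal.ofReal_le_ofReal ?_
            rw [norm_div, div_eq_mul_inv, mul_pow, Complex.norm_real, Real.norm_eq_abs]
            have h2 : |φu (g * t)| ≤ U := by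
              have hU0 : 0 ≤ U := by
                have := (abs_nonneg _).trans (hU 1)
                simpa using this
              refine (hU _).trans (mul_le_of_le_one_right hU0 ?_)
              exact Real.rpow_le_one (abs_nonneg _) (abs_mul_le_one_of_mem_window hg ht) hα.le
            gcongr
            exact hR t (abs_le_of_mem_window ht)
          · simp [atomWeight, Set.indicator_of_notMem ht]
      _ = _ := by
          rw [lintegral_indicator (measurableSet_window g), setLIntegral_const, volume_window,
            ← ENNReal.ofReal_mul (by positivity)]
  have hbound := integral_normSq_charIntegral_le (observationLaw p f k) hi
    (continuous_densityCF hk).measurable (norm_charFun_observationLaw_le h0 h1 hf hk)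
  have hci : ∫ x, ‖charIntegral (atomWeight (densityCF k) φu g) x‖ ^ 2 ∂(observationLaw p f k) ≤
      2 * (U ^ 2 * R * (2 / g)) * ∫ t, ‖densityCF k t‖ := by
    rw [← ENNReal.ofReal_le_ofReal_iff (by positivity)]
    refine hbound.trans ?_
    rw [ENNReal.ofReal_mul (by positivity), ENNReal.ofReal_mul (by positivity),
      ofReal_integral_norm_eq_lintegral_enorm hint]
    gcongr
    simp
  have hbd : ∀ x, ‖‖charIntegral (atomWeight (densityCF k) φu g) x‖ ^ 2‖ ≤
      (∫ t, ‖atomWeight (densityCF k) φu g t‖) ^ 2 := by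
    intro x
    rw [norm_pow, norm_norm]
    gcongr
    exact norm_charIntegral_le _ x
  have hcont := continuous_charIntegral hi
  calc ∫ x, atomScore (densityCF k) φu g x ^ 2 ∂(observationLaw p f k)
      ≤ ∫ x, (g / 2) ^ 2 * ‖charIntegral (atomWeight (densityCF k) φu g) x‖ ^ 2
          ∂(observationLaw p f k) := by
        refine integral_mono_of_nonneg (Eventually.of_forall fun x => sq_nonneg _) ?_
          (Eventually.of_forall fun x => ?_)
        · exact (Integrable.of_bound (by fun_prop) _ (Eventually.of_forall hbd)).const_mul _
        · simp only [atomScore, mul_pow]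
          gcongr ?_ * ?_
          rw [← sq_abs]
          gcongr
          exact Complex.abs_re_le_norm _
    _ ≤ (g / 2) ^ 2 * (2 * (U ^ 2 * R * (2 / g)) * ∫ t, ‖densityCF k t‖) := by
        rw [integral_const_mul]
        gcongr
    _ = _ := by field_simp

/-- Since `φ_u` has integral 2, the constant `p` in `φ_X / φ_Z` is reproduced exactly; only the
average of `(1 - p) φ_f` against `φ_u(gt)` remains, and the vanishing of `φ_u` at 0 to order `α`
makes it small. -/
theorem sq_integral_atomScore_sub_le (h0 : 0 ≤ p) (h1 : p ≤ 1)
    (hf : f ∈ sobolevDensities α K) (hK : 0 < K)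
    (hk : IsProbDensity k) (hne : ∀ t, densityCF k t ≠ 0)
    (hu : IsAtomKernelFT φu α) (hg : 0 < g) (hU : ∀ t, |φu t| ≤ U * |t| ^ α) :
    (∫ x, atomScore (densityCF k) φu g x ∂(observationLaw p f k) - p) ^ 2 ≤
      U ^ 2 * K * (g * g ^ (2 * α)) := by
  obtain ⟨hf, hfK⟩ := hf
  have := isProbabilityMeasure_observationLaw h0 h1 hf hk
  have hi := integrable_atomWeight hk hne hu hg
  have hcont := continuous_charIntegral hi
  have hle : -1 / g ≤ 1 / g := by gcongr; norm_num
  have hU0 : 0 ≤ U := by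
    have := (abs_nonneg _).trans (hU 1)
    simpa using this
  have hci : Integrable (charIntegral (atomWeight (densityCF k) φu g)) (observationLaw p f k) :=
    Integrable.of_bound hcont.aestronglyMeasurable _
      (Eventually.of_forall (norm_charIntegral_le _))
  have hui : Integrable (fun t => φu (g * t)) := hu.integrable.comp_mul_left' hg.ne'
  have hufi : Integrable (fun t => (φu (g * t) : ℂ) * densityCF f t) :=
    hui.ofReal.mul_bdd (c := 1) (continuous_densityCF hf).aestronglyMeasurable
      (Eventually.of_forall (norm_densityCF_le_one hf))
  have hmass : ∫ t in window g, φu (g * t) = 2 / g := by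
    rw [window, ← intervalIntegral.integral_of_le hle,
      intervalIntegral.integral_comp_mul_left _ hg.ne']
    have e1 : g * (-1 / g) = -1 := by field_simp
    have e2 : g * (1 / g) = 1 := by field_simp
    rw [e1, e2, hu.integral_eq_two, smul_eq_mul]
    field_simp
  have hmean : ∫ x, atomScore (densityCF k) φu g x ∂(observationLaw p f k) - p =
      g / 2 * ((1 - p : ℝ) * ∫ t in window g, (φu (g * t) : ℂ) * densityCF f t).re := by
    have h2 : ∫ x, charIntegral (atomWeight (densityCF k) φu g) x ∂(observationLaw p f k) =
        p * (2 / g : ℝ) + (1 - p : ℝ) * ∫ t in window g, (φu (g * t) : ℂ) * densityCF f t := by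
      rw [integral_charIntegral _ hi]
      have h3 : ∀ t, atomWeight (densityCF k) φu g t * charFun (observationLaw p f k) t =
          (window g).indicator (fun t => (p : ℂ) * (φu (g * t) : ℂ) +
            (1 - p : ℝ) * ((φu (g * t) : ℂ) * densityCF f t)) t := by
        intro t
        by_cases ht : t ∈ window g
        · rw [atomWeight, Set.indicator_of_mem ht, Set.indicator_of_mem ht,
            charFun_observationLaw h0 h1 hf hk]
          have := hne t
          field_simp
          push_cast
          ring
        · simp [atomWeight, Set.indicator_of_notMem ht]
      simp only [h3]
      rw [integral_indicator (measurableSet_window g), integral_add, integral_const_mul,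
        integral_const_mul, integral_complex_ofReal, hmass]
      · exact (hui.ofReal.const_mul _).integrableOn
      · exact (hufi.const_mul _).integrableOn
    simp only [atomScore]
    rw [integral_const_mul]
    have h4 : ∫ x, (charIntegral (atomWeight (densityCF k) φu g) x).re ∂(observationLaw p f k) =
      (∫ x, charIntegral (atomWeight (densityCF k) φu g) x ∂(observationLaw p f k)).re :=
      integral_re hci
    rw [h4, h2, Complex.add_re, ← Complex.ofReal_mul, Complex.ofReal_re]
    field_simp
    ring
  have habs : |∫ x, atomScore (densityCF k) φu g x ∂(observationLaw p f k) - p| ≤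
      g / 2 * ‖∫ t in window g, (φu (g * t) : ℂ) * densityCF f t‖ := by
    rw [hmean, abs_mul, abs_of_pos (by positivity : 0 < g / 2)]
    gcongr
    refine (Complex.abs_re_le_norm _).trans ?_
    rw [norm_mul, Complex.norm_real, Real.norm_of_nonneg (sub_nonneg.2 h1)]
    exact mul_le_of_le_one_left (norm_nonneg _) (by linarith)
  have hnorm : ‖∫ t in window g, (φu (g * t) : ℂ) * densityCF f t‖ₑ ^ 2 ≤
      ENNReal.ofReal (2 / g * (U ^ 2 * g ^ (2 * α) * K)) := by
    calc ‖∫ t in window g, (φu (g * t) : ℂ) * densityCF f t‖ₑ ^ 2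
        ≤ (∫⁻ t in window g, ‖(φu (g * t) : ℂ) * densityCF f t‖ₑ) ^ 2 := by
          gcongr; exact enorm_integral_le_lintegral_enorm _
      -- Cauchy–Schwarz on a window of length `2/g`; against the prefactor `(g/2)²` this leaves the
      -- factor `g`.
      _ ≤ ENNReal.ofReal (2 / g) *
          ∫⁻ t in window g, ‖(φu (g * t) : ℂ) * densityCF f t‖ₑ ^ 2 := by
          have := sq_lintegral_le (volume.restrict (window g))
            (hufi.1.enorm.restrict (s := window g))
          rwa [Measure.restrict_apply_univ, volume_window] at this
      -- `|φ_u(gt)|² ≤ U² g^(2α) |t|^(2α)`, and the power of `t` is absorbed by the Sobolev weight.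
      _ ≤ ENNReal.ofReal (2 / g) * ∫⁻ t, ENNReal.ofReal (U ^ 2 * g ^ (2 * α)) *
          (‖densityCF f t‖ₑ ^ 2 * ENNReal.ofReal (1 + |t| ^ (2 * α))) := by
          refine mul_le_mul' le_rfl ?_
          refine (setLIntegral_le_lintegral _ _).trans (lintegral_mono fun t => ?_)
          rw [enorm_mul, mul_pow, mul_comm, mul_left_comm]
          gcongr
          rw [← ofReal_norm, ← ENNReal.ofReal_pow (norm_nonneg _),
            ← ENNReal.ofReal_mul (by positivity)]
          refine ENNReal.ofReal_le_ofReal ?_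
          rw [Complex.norm_real, Real.norm_eq_abs]
          have e : ∀ x : ℝ, 0 ≤ x → (x ^ α) ^ 2 = x ^ (2 * α) := by
            intro x hx
            rw [← Real.rpow_natCast, ← Real.rpow_mul hx]; congr 1; push_cast; ring
          calc |φu (g * t)| ^ 2 ≤ (U * |g * t| ^ α) ^ 2 := by gcongr; exact hU _
            _ = U ^ 2 * g ^ (2 * α) * |t| ^ (2 * α) := by
              rw [mul_pow, e _ (abs_nonneg _), abs_mul, abs_of_pos hg,
                Real.mul_rpow hg.le (abs_nonneg _)]
              ring
            _ ≤ _ := by gcongr; linarith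
      _ ≤ ENNReal.ofReal (2 / g) * (ENNReal.ofReal (U ^ 2 * g ^ (2 * α)) * ENNReal.ofReal K) := by
          rw [lintegral_const_mul' _ _ ENNReal.ofReal_ne_top]
          gcongr
      _ = _ := by
          rw [← ENNReal.ofReal_mul (by positivity), ← ENNReal.ofReal_mul (by positivity)]
  rw [← ofReal_norm, ← ENNReal.ofReal_pow (norm_nonneg _),
    ENNReal.ofReal_le_ofReal_iff (by positivity)] at hnorm
  calc (∫ x, atomScore (densityCF k) φu g x ∂(observationLaw p f k) - p) ^ 2
      = |∫ x, atomScore (densityCF k) φu g x ∂(observationLaw p f k) - p| ^ 2 := (sq_abs _).symm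
    _ ≤ (g / 2 * ‖∫ t in window g, (φu (g * t) : ℂ) * densityCF f t‖) ^ 2 := by gcongr
    _ = (g / 2) ^ 2 * ‖∫ t in window g, (φu (g * t) : ℂ) * densityCF f t‖ ^ 2 := by ring
    _ ≤ (g / 2) ^ 2 * (2 / g * (U ^ 2 * g ^ (2 * α) * K)) := by gcongr
    _ = U ^ 2 * K * (g * g ^ (2 * α)) / 2 := by field_simp
    _ ≤ _ := half_le_self (by positivity)

theorem lintegral_sq_atomEstimator_sub_le (h0 : 0 ≤ p) (h1 : p ≤ 1) (hf : IsProbDensity f)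
    (hk : IsProbDensity k) (hne : ∀ t, densityCF k t ≠ 0) (hint : Integrable (densityCF k))
    (hα : 0 < α) (hu : IsAtomKernelFT φu α) (hg : 0 < g) (hU : ∀ t, |φu t| ≤ U * |t| ^ α)
    (hR : ∀ t, |t| ≤ 1 / g → (‖densityCF k t‖⁻¹) ^ 2 ≤ R) {n : ℕ} {s : Finset (Fin n)}
    (hs : s.Nonempty) :
    ∫⁻ X, ENNReal.ofReal ((atomEstimator (densityCF k) φu g (empCF X s) -
      ∫ x, atomScore (densityCF k) φu g x ∂(observationLaw p f k)) ^ 2) ∂(sampleLaw n p f k) ≤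
      ENNReal.ofReal ((s.card : ℝ)⁻¹ * (g * U ^ 2 * R * ∫ t, ‖densityCF k t‖)) := by
  have := isProbabilityMeasure_observationLaw h0 h1 hf hk
  simp only [atomEstimator_empCF hk hne hu hg]
  refine (lintegral_sq_average_sub_le (observationLaw p f k) hs
    (continuous_atomScore hk hne hu hg).measurable
    (abs_atomScore_le (densityCF k) φu hg)).trans (ENNReal.ofReal_le_ofReal ?_)
  gcongr
  exact integral_atomScore_sq_le h0 h1 hf hk hne hint hα hu hg hU hR

end

/-! ### Fourier-side decomposition of the integrated squared error. -/

noncomputable section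

theorem lintegral_comp_mul_right {c : ℝ} (hc : c ≠ 0) (F : ℝ → ℝ≥0∞) :
    ∫⁻ s, F (s * c) = ENNReal.ofReal |c⁻¹| * ∫⁻ t, F t := by
  rw [← (measurableEmbedding_mulRight₀ hc).lintegral_map, Real.map_volume_mul_right hc,
    lintegral_smul_measure, smul_eq_mul]

theorem memLp_of_norm_le_of_support {F : ℝ → ℂ} {a b C : ℝ} (hF : AEStronglyMeasurable F)
    (hC : ∀ t ∈ Set.Icc a b, ‖F t‖ ≤ C) (h0 : ∀ t ∉ Set.Icc a b, F t = 0) (q : ℝ≥0∞) :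
    MemLp F q := by
  have h1 : MemLp ((Set.Icc a b).indicator fun _ : ℝ => C) q volume :=
    memLp_indicator_const q measurableSet_Icc C (Or.inr (by simp))
  refine h1.mono hF (Eventually.of_forall fun t => ?_)
  by_cases ht : t ∈ Set.Icc a b
  · rw [Set.indicator_of_mem ht]
    exact (hC t ht).trans (Real.le_norm_self C)
  · rw [h0 t ht]; simp

variable {α K W p q h : ℝ} {f k φw : ℝ → ℝ}

theorem IsDensityKernelFT.abs_le_one_add (hw : IsDensityKernelFT φw α) (hα : 0 < α) (hW0 : 0 < W)
    (hW : ∀ t, |φw t - 1| ≤ W * |t| ^ α) (t : ℝ) : |φw t| ≤ 1 + W := by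
  by_cases ht : t ∈ Set.Icc (-1 : ℝ) 1
  · have h1 := hW t
    have h2 : |t| ^ α ≤ 1 := Real.rpow_le_one (abs_nonneg _) (abs_le.2 ht) hα.le
    have h3 := abs_sub_abs_le_abs_sub (φw t) 1
    rw [abs_one] at h3
    nlinarith
  · rw [Function.notMem_support.1 fun hs => ht (hw.support_subset hs)]
    simp; positivity

theorem IsDensityKernelFT.comp_mul_eq_zero (hw : IsDensityKernelFT φw α) (hh : 0 < h) {t : ℝ}
    (ht : t ∉ Set.Icc (-1 / h) (1 / h)) : φw (h * t) = 0 := by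
  refine Function.notMem_support.1 fun hs => ht ?_
  obtain ⟨h1, h2⟩ := hw.support_subset hs
  exact ⟨by rw [div_le_iff₀ hh]; linarith, by rw [le_div_iff₀ hh]; linarith⟩

theorem IsDensityKernelFT.aestronglyMeasurable_comp_mul (hw : IsDensityKernelFT φw α)
    (hα : 0 < α) (hh : 0 < h) : AEStronglyMeasurable (fun t => (φw (h * t) : ℂ)) := by
  obtain ⟨W, hW0, hW⟩ := hw.bound
  have h1 : MemLp (fun t => (φw t : ℂ)) 1 :=
    memLp_of_norm_le_of_support (a := -1) (b := 1) (C := 1 + W)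
      (Complex.continuous_ofReal.comp_aestronglyMeasurable hw.square_integrable.1)
      (fun t _ => by rw [Complex.norm_real]; exact hw.abs_le_one_add hα hW0 hW t)
      (fun t ht => by
        rw [Function.notMem_support.1 fun hs => ht (hw.support_subset hs), Complex.ofReal_zero]) 1
  exact ((memLp_one_iff_integrable.1 h1).comp_mul_left' hh.ne').1

/-- The Fourier transform of the density estimator. -/
def estimatorFT (φZ : ℝ → ℂ) (φw : ℝ → ℝ) (h q : ℝ) (φemp : ℝ → ℂ) (t : ℝ) : ℂ :=
  (φemp t - q * φZ t) / ((1 - q) * φZ t) * (φw (h * t) : ℂ)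

/-- The function is bounded and supported in `[-1/h, 1/h]`, hence in every `L^r`; Plancherel needs
`r = 1` and `r = 2`. -/
theorem memLp_estimatorFT (hk : IsProbDensity k) (hne : ∀ t, densityCF k t ≠ 0) (hα : 0 < α)
    (hw : IsDensityKernelFT φw α) (hh : 0 < h) (hq : q < 1) {φemp : ℝ → ℂ}
    (hemp : Continuous φemp) (r : ℝ≥0∞) : MemLp (estimatorFT (densityCF k) φw h q φemp) r := by
  obtain ⟨W, hW0, hW⟩ := hw.bound
  have hkc := continuous_densityCF hk
  have hq' : (1 - q : ℂ) ≠ 0 := by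
    rw [← Complex.ofReal_one, ← Complex.ofReal_sub, Complex.ofReal_ne_zero]
    linarith
  have hcont : Continuous fun t => (φemp t - q * densityCF k t) / ((1 - q) * densityCF k t) :=
    Continuous.div (by fun_prop) (by fun_prop) fun t => mul_ne_zero hq' (hne t)
  obtain ⟨C, hC⟩ := (isCompact_Icc (a := -1 / h) (b := 1 / h)).exists_bound_of_continuousOn
    hcont.continuousOn
  refine memLp_of_norm_le_of_support (F := estimatorFT (densityCF k) φw h q φemp)
    (a := -1 / h) (b := 1 / h) (C := C * (1 + W))
    (hcont.aestronglyMeasurable.mul (hw.aestronglyMeasurable_comp_mul hα hh)) (fun t ht => ?_)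
    (fun t ht => ?_) r
  · rw [estimatorFT, norm_mul, Complex.norm_real]
    have := hC t ht
    have h0 := (norm_nonneg _).trans this
    gcongr
    exact hw.abs_le_one_add hα hW0 hW _
  · rw [estimatorFT, hw.comp_mul_eq_zero hh ht, Complex.ofReal_zero, mul_zero]

/-- The substitution `t = -2πs` absorbs the factor `1/(2π)`. -/
theorem densityEstimator_eq_fourierInv (φZ : ℝ → ℂ) (φw : ℝ → ℝ) (h q : ℝ) (φemp : ℝ → ℂ)
    (x : ℝ) : densityEstimator φZ φw h q φemp x = FourierTransformInv.fourierInv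
      (fun s => estimatorFT φZ φw h q φemp (s * (-(2 * Real.pi)))) x := by
  rw [Real.fourierInv_eq']
  have h1 := Measure.integral_comp_mul_right (fun t : ℝ =>
    Complex.exp (-(Complex.I * t * x)) * estimatorFT φZ φw h q φemp t) (-(2 * Real.pi))
  rw [densityEstimator]
  have h2 : |(-(2 * Real.pi))⁻¹| = 1 / (2 * Real.pi) := by
    rw [abs_inv, abs_neg, abs_of_pos (by positivity), one_div]
  rw [h2, Complex.real_smul] at h1
  simp only [estimatorFT, mul_assoc] at h1 ⊢
  rw [← h1]
  refine integral_congr_ae (Eventually.of_forall fun s => ?_)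
  simp only [smul_eq_mul]
  congr 2
  simp
  ring

theorem lintegral_densityCF_sq_lt_top (hfK : ∫⁻ t : ℝ, ‖densityCF f t‖ₑ ^ 2 *
    ENNReal.ofReal (1 + |t| ^ (2 * α)) ≤ ENNReal.ofReal K) :
    ∫⁻ t : ℝ, ‖densityCF f t‖ₑ ^ 2 < ∞ := by
  refine lt_of_le_of_lt ((lintegral_mono fun t => ?_).trans hfK) ENNReal.ofReal_lt_top
  refine le_mul_of_one_le_right' ?_
  rw [ENNReal.one_le_ofReal]
  have : 0 ≤ |t| ^ (2 * α) := by positivity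
  linarith

/-- Plancherel's identity for the density estimator. -/
theorem lintegral_densityEstimator_sub_sq (hα : 0 < α) (hf : f ∈ sobolevDensities α K)
    (hk : IsProbDensity k) (hne : ∀ t, densityCF k t ≠ 0) (hw : IsDensityKernelFT φw α)
    (hh : 0 < h) (hq : q < 1) {φemp : ℝ → ℂ} (hemp : Continuous φemp) :
    ∫⁻ x : ℝ, ‖densityEstimator (densityCF k) φw h q φemp x - (f x : ℂ)‖ₑ ^ 2 =
      ENNReal.ofReal (1 / (2 * Real.pi)) *
        ∫⁻ t, ‖estimatorFT (densityCF k) φw h q φemp t - densityCF f t‖ₑ ^ 2 := by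
  obtain ⟨hf, hfK⟩ := hf
  have hc : -(2 * Real.pi) ≠ 0 := by simp [Real.pi_ne_zero]
  have hcabs : |(-(2 * Real.pi))⁻¹| = 1 / (2 * Real.pi) := by
    rw [abs_inv, abs_neg, abs_of_pos (by positivity), one_div]
  have hG := memLp_estimatorFT hk hne hα hw hh hq hemp
  have hG1 : Integrable fun s => estimatorFT (densityCF k) φw h q φemp (s * (-(2 * Real.pi))) :=
    (memLp_one_iff_integrable.1 (hG 1)).comp_mul_right' hc
  have sq : ∀ F : ℝ → ℂ, AEStronglyMeasurable F → (∫⁻ t, ‖F t‖ₑ ^ 2 < ∞ ↔ MemLp F 2) := by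
    intro F hF
    have h2 := eLpNorm_lt_top_iff_lintegral_rpow_enorm_lt_top (f := F) (μ := volume)
      (p := 2) (by norm_num) (by norm_num)
    simp only [ENNReal.toReal_ofNat, ENNReal.rpow_ofNat] at h2
    exact h2.symm.trans ⟨fun h => ⟨hF, h⟩, fun h => h.2⟩
  have hG2 : MemLp (fun s => estimatorFT (densityCF k) φw h q φemp (s * (-(2 * Real.pi)))) 2 := by
    rw [← sq _ hG1.1, lintegral_comp_mul_right hc
      (fun t => ‖estimatorFT (densityCF k) φw h q φemp t‖ₑ ^ 2)]
    exact ENNReal.mul_lt_top ENNReal.ofReal_lt_top ((sq _ (hG 2).1).2 (hG 2))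
  have hF : FourierTransform.fourier (fun x => (f x : ℂ)) =
      fun s => densityCF f (s * (-(2 * Real.pi))) := by
    ext s; rw [densityCF_eq_fourier hf]
  have hf2 : MemLp (FourierTransform.fourier (fun x => (f x : ℂ))) 2 := by
    have hcont := continuous_densityCF hf
    rw [hF, ← sq _ (Continuous.aestronglyMeasurable (by fun_prop)),
      lintegral_comp_mul_right hc (fun t => ‖densityCF f t‖ₑ ^ 2)]
    exact ENNReal.mul_lt_top ENNReal.ofReal_lt_top (lintegral_densityCF_sq_lt_top hfK)
  have hfi : Integrable fun x => (f x : ℂ) := hf.integrable.ofReal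
  have key := lintegral_enorm_fourierInv_sub_sq hfi hG1 hG2 hf2
  simp only [densityEstimator_eq_fourierInv]
  rw [key, hF, lintegral_comp_mul_right hc
    (fun t => ‖estimatorFT (densityCF k) φw h q φemp t - densityCF f t‖ₑ ^ 2), hcabs]

theorem enorm_add_add_sq_le (a b c : ℂ) :
    ‖a + b + c‖ₑ ^ 2 ≤ 3 * (‖a‖ₑ ^ 2 + ‖b‖ₑ ^ 2 + ‖c‖ₑ ^ 2) := by
  have h1 : ‖a + b + c‖ ^ 2 ≤ 3 * (‖a‖ ^ 2 + ‖b‖ ^ 2 + ‖c‖ ^ 2) := by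
    have := norm_add₃_le (a := a) (b := b) (c := c)
    have h2 : ‖a + b + c‖ ^ 2 ≤ (‖a‖ + ‖b‖ + ‖c‖) ^ 2 := by gcongr
    nlinarith [sq_nonneg (‖a‖ - ‖b‖), sq_nonneg (‖a‖ - ‖c‖), sq_nonneg (‖b‖ - ‖c‖)]
  have h2 := ENNReal.ofReal_le_ofReal h1
  rw [ENNReal.ofReal_mul (by norm_num), ENNReal.ofReal_add (by positivity) (by positivity),
    ENNReal.ofReal_add (by positivity) (by positivity)] at h2
  simpa [ENNReal.ofReal_pow, ofReal_norm] using h2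

/-- Decomposition of the integrated squared error into the stochastic error of the empirical
characteristic function, the error of the estimated atom, and the bias. -/
theorem lintegral_densityEstimator_sub_sq_le (hα : 0 < α) (hf : f ∈ sobolevDensities α K)
    (hk : IsProbDensity k) (hne : ∀ t, densityCF k t ≠ 0) (hw : IsDensityKernelFT φw α)
    (hW0 : 0 < W) (hW : ∀ t, |φw t - 1| ≤ W * |t| ^ α) (h0 : 0 ≤ p) (h1 : p < 1)
    (hh : 0 < h) (hq : q < 1) {φemp : ℝ → ℂ} (hemp : Continuous φemp) :
    ∫⁻ x : ℝ, ‖densityEstimator (densityCF k) φw h q φemp x - (f x : ℂ)‖ₑ ^ 2 ≤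
      ENNReal.ofReal ((1 + W) ^ 2 * ((1 - q)⁻¹) ^ 2) *
        (∫⁻ t in Set.Icc (-1 / h) (1 / h),
          ‖(φemp t - charFun (observationLaw p f k) t) / densityCF k t‖ₑ ^ 2) +
      ENNReal.ofReal (8 * (1 + W) ^ 2 / h * ((q - p) / (1 - q)) ^ 2) +
      ENNReal.ofReal (W ^ 2 * h ^ (2 * α) * K) := by
  rw [lintegral_densityEstimator_sub_sq hα hf hk hne hw hh hq hemp]
  obtain ⟨hf, hfK⟩ := hf
  have := isProbabilityMeasure_observationLaw h0 h1.le hf hk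
  have hkc := continuous_densityCF hk
  have hfc := continuous_densityCF hf
  have hXc : Continuous (charFun (observationLaw p f k)) := continuous_charFun
  have hq' : (1 - q : ℂ) ≠ 0 := by
    rw [← Complex.ofReal_one, ← Complex.ofReal_sub, Complex.ofReal_ne_zero]
    linarith
  set r : ℝ → ℂ := fun t => (φemp t - charFun (observationLaw p f k) t) / densityCF k t with hr
  have hrc : Continuous r := (hemp.sub hXc).div hkc hne
  set S := Set.Icc (-1 / h) (1 / h)
  set A : ℝ → ℝ≥0∞ := S.indicator fun t =>
    ENNReal.ofReal ((1 + W) ^ 2 * ((1 - q)⁻¹) ^ 2) * ‖r t‖ₑ ^ 2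
  set B : ℝ → ℝ≥0∞ := S.indicator fun _ =>
    ENNReal.ofReal (4 * (1 + W) ^ 2 * ((q - p) / (1 - q)) ^ 2)
  set D : ℝ → ℝ≥0∞ := fun t => ENNReal.ofReal (W ^ 2 * h ^ (2 * α)) *
    (‖densityCF f t‖ₑ ^ 2 * ENNReal.ofReal (1 + |t| ^ (2 * α)))
  have hpt : ∀ t, ‖estimatorFT (densityCF k) φw h q φemp t - densityCF f t‖ₑ ^ 2 ≤
      3 * (A t + B t + D t) := by
    intro t
    -- After `φ_emp` is centred at `φ_X`, the identity is `(p + (1 - p) φ_f - q) / (1 - q) - φ_f =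
    -- -(1 - φ_f) (q - p) / (1 - q)`.
    have hdec : estimatorFT (densityCF k) φw h q φemp t - densityCF f t =
        ((1 - q)⁻¹ : ℝ) * r t * φw (h * t) +
        (1 - densityCF f t) * (-((q - p) / (1 - q)) : ℝ) * φw (h * t) +
        densityCF f t * (φw (h * t) - 1 : ℝ) := by
      rw [estimatorFT, hr]
      simp only [charFun_observationLaw h0 h1.le hf hk]
      have := hne t
      push_cast
      field_simp
      ring
    rw [hdec]
    refine (enorm_add_add_sq_le _ _ _).trans ?_
    have hD : ‖densityCF f t * (φw (h * t) - 1 : ℝ)‖ₑ ^ 2 ≤ D t := by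
      simp only [D]
      rw [enorm_mul, mul_pow, mul_left_comm]
      gcongr
      rw [← ofReal_norm, ← ENNReal.ofReal_pow (norm_nonneg _),
        ← ENNReal.ofReal_mul (by positivity)]
      refine ENNReal.ofReal_le_ofReal ?_
      rw [Complex.norm_real, Real.norm_eq_abs]
      have e : ∀ x : ℝ, 0 ≤ x → (x ^ α) ^ 2 = x ^ (2 * α) := by
        intro x hx
        rw [← Real.rpow_natCast, ← Real.rpow_mul hx]; congr 1; push_cast; ring
      calc |φw (h * t) - 1| ^ 2 ≤ (W * |h * t| ^ α) ^ 2 := by gcongr; exact hW _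
        _ = W ^ 2 * h ^ (2 * α) * |t| ^ (2 * α) := by
          rw [mul_pow, e _ (abs_nonneg _), abs_mul, abs_of_pos hh,
            Real.mul_rpow hh.le (abs_nonneg _)]
          ring
        _ ≤ _ := by gcongr; linarith
    by_cases ht : t ∈ S
    · have hB : |φw (h * t)| ≤ 1 + W := hw.abs_le_one_add hα hW0 hW _
      gcongr 3 * (?_ + ?_ + ?_)
      · simp only [A, Set.indicator_of_mem ht]
        rw [← ofReal_norm, ← ofReal_norm, ← ENNReal.ofReal_pow (norm_nonneg _),
          ← ENNReal.ofReal_pow (norm_nonneg _), ← ENNReal.ofReal_mul (by positivity)]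
        refine ENNReal.ofReal_le_ofReal ?_
        rw [norm_mul, norm_mul, Complex.norm_real, Complex.norm_real, Real.norm_eq_abs,
          Real.norm_eq_abs, mul_pow, mul_pow, sq_abs]
        calc (1 - q)⁻¹ ^ 2 * ‖r t‖ ^ 2 * |φw (h * t)| ^ 2
            ≤ (1 - q)⁻¹ ^ 2 * ‖r t‖ ^ 2 * (1 + W) ^ 2 := by gcongr
          _ = _ := by ring
      · simp only [B, Set.indicator_of_mem ht]
        rw [← ofReal_norm, ← ENNReal.ofReal_pow (norm_nonneg _)]
        refine ENNReal.ofReal_le_ofReal ?_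
        rw [norm_mul, norm_mul, Complex.norm_real, Complex.norm_real, Real.norm_eq_abs,
          Real.norm_eq_abs, mul_pow, mul_pow, abs_neg, sq_abs]
        have h2 : ‖1 - densityCF f t‖ ≤ 2 := by
          refine (norm_sub_le _ _).trans ?_
          rw [norm_one]
          linarith [norm_densityCF_le_one hf t]
        calc ‖1 - densityCF f t‖ ^ 2 * ((q - p) / (1 - q)) ^ 2 * |φw (h * t)| ^ 2
            ≤ 2 ^ 2 * ((q - p) / (1 - q)) ^ 2 * (1 + W) ^ 2 := by gcongr
          _ = _ := by ring
    -- Outside the band `φ_w(ht) = 0`, so only the bias term survives.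
    · have hz := hw.comp_mul_eq_zero hh ht
      simp only [A, B, Set.indicator_of_notMem ht]
      rw [hz, Complex.ofReal_zero, mul_zero, mul_zero, enorm_zero]
      gcongr
      · simp
      · simp
      · rw [← hz]; exact hD
  have hAm : Measurable A := Measurable.indicator (by fun_prop) measurableSet_Icc
  have hBm : Measurable B := measurable_const.indicator measurableSet_Icc
  have hAi : ∫⁻ t, A t = ENNReal.ofReal ((1 + W) ^ 2 * ((1 - q)⁻¹) ^ 2) *
      ∫⁻ t in S, ‖r t‖ₑ ^ 2 := by
    simp only [A]
    rw [lintegral_indicator measurableSet_Icc, lintegral_const_mul _ (by fun_prop)]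
  -- The constant is `8 = 4 · 2`: `|1 - φ_f|² ≤ 4` and the band has length `2/h`.
  have hBi : ∫⁻ t, B t = ENNReal.ofReal (8 * (1 + W) ^ 2 / h * ((q - p) / (1 - q)) ^ 2) := by
    simp only [B]
    rw [lintegral_indicator measurableSet_Icc, setLIntegral_const, Real.volume_Icc,
      ← ENNReal.ofReal_mul (by positivity)]
    congr 1
    ring
  have hDi : ∫⁻ t, D t ≤ ENNReal.ofReal (W ^ 2 * h ^ (2 * α) * K) := by
    simp only [D]
    rw [lintegral_const_mul' _ _ ENNReal.ofReal_ne_top,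
      ENNReal.ofReal_mul (p := W ^ 2 * h ^ (2 * α)) (by positivity)]
    gcongr
  -- The 3 from squaring a sum of three terms is paid for by `1/(2π)`.
  have hpi : ENNReal.ofReal (1 / (2 * Real.pi)) * 3 ≤ 1 := by
    have : (3 : ℝ≥0∞) = ENNReal.ofReal 3 := by simp
    rw [this, ← ENNReal.ofReal_mul (by positivity), ENNReal.ofReal_le_one,
      div_mul_eq_mul_div, div_le_one (by positivity)]
    linarith [Real.pi_gt_three]
  calc ENNReal.ofReal (1 / (2 * Real.pi)) *
        ∫⁻ t, ‖estimatorFT (densityCF k) φw h q φemp t - densityCF f t‖ₑ ^ 2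
      ≤ ENNReal.ofReal (1 / (2 * Real.pi)) * ∫⁻ t, 3 * (A t + B t + D t) := by
        gcongr with t; exact hpt t
    _ = ENNReal.ofReal (1 / (2 * Real.pi)) * 3 * ∫⁻ t, (A t + B t + D t) := by
        rw [lintegral_const_mul' _ _ (by norm_num), mul_assoc]
    _ ≤ ∫⁻ t, (A t + B t + D t) := mul_le_of_le_one_left' hpi
    _ = (∫⁻ t, A t) + (∫⁻ t, B t) + ∫⁻ t, D t := by
        rw [lintegral_add_left (f := fun t => A t + B t) (hAm.add hBm), lintegral_add_left hAm]
    _ ≤ _ := by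
        rw [hAi, hBi]
        gcongr

end

/-! ### Truncation and the relative error of the estimated atom. -/

noncomputable section

theorem card_firstHalf (n : ℕ) : (firstHalf n).card = n / 2 := by
  rw [firstHalf, Fin.card_filter_val_lt]
  omega

theorem card_secondHalf (n : ℕ) : (secondHalf n).card = n - n / 2 := by
  have h1 : secondHalf n = (firstHalf n)ᶜ := by
    ext j
    simp [firstHalf, secondHalf]
  rw [h1, Finset.card_compl, card_firstHalf, Fintype.card_fin]

theorem disjoint_firstHalf_secondHalf (n : ℕ) : Disjoint (firstHalf n) (secondHalf n) := by
  rw [Finset.disjoint_left]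
  intro j hj hj'
  simp only [firstHalf, secondHalf, Finset.mem_filter] at hj hj'
  omega

variable {α K W U p q h g R L δ : ℝ} {f k φu φw : ℝ → ℝ}

theorem isProbabilityMeasure_sampleLaw (h0 : 0 ≤ p) (h1 : p ≤ 1) (hf : IsProbDensity f)
    (hk : IsProbDensity k) (n : ℕ) : IsProbabilityMeasure (sampleLaw n p f k) := by
  have := isProbabilityMeasure_observationLaw h0 h1 hf hk
  unfold sampleLaw
  infer_instance

theorem measurable_empCF_error (h0 : 0 ≤ p) (h1 : p ≤ 1) (hf : IsProbDensity f)
    (hk : IsProbDensity k) {n : ℕ} (s : Finset (Fin n)) :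
    Measurable (fun z : (Fin n → ℝ) × ℝ =>
      ‖(empCF z.1 s z.2 - charFun (observationLaw p f k) z.2) / densityCF k z.2‖ₑ ^ 2) := by
  have := isProbabilityMeasure_observationLaw h0 h1 hf hk
  have hX : Measurable (charFun (observationLaw p f k)) := continuous_charFun.measurable
  have hZ := (continuous_densityCF hk).measurable
  have hE := (continuous_empCF s).measurable
  exact (((hE.sub (hX.comp measurable_snd)).div (hZ.comp measurable_snd)).enorm).pow_const 2

theorem lintegral_empCF_error_le (h0 : 0 ≤ p) (h1 : p ≤ 1) (hf : IsProbDensity f)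
    (hk : IsProbDensity k) (hh : 0 < h)
    (hR : ∀ t, |t| ≤ 1 / h → (‖densityCF k t‖⁻¹) ^ 2 ≤ R) {n : ℕ} {s : Finset (Fin n)}
    (hs : s.Nonempty) :
    ∫⁻ X, (∫⁻ t in Set.Icc (-1 / h) (1 / h),
      ‖(empCF X s t - charFun (observationLaw p f k) t) / densityCF k t‖ₑ ^ 2)
      ∂(sampleLaw n p f k) ≤ ENNReal.ofReal ((s.card : ℝ)⁻¹ * (R * (2 / h))) := by
  have := isProbabilityMeasure_observationLaw h0 h1 hf hk
  have := isProbabilityMeasure_sampleLaw h0 h1 hf hk n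
  have hR0 : 0 ≤ R := (sq_nonneg _).trans (hR 0 (by simp; positivity))
  rw [lintegral_lintegral_swap (measurable_empCF_error h0 h1 hf hk s).aemeasurable]
  calc ∫⁻ t in Set.Icc (-1 / h) (1 / h), ∫⁻ X,
        ‖(empCF X s t - charFun (observationLaw p f k) t) / densityCF k t‖ₑ ^ 2
        ∂(sampleLaw n p f k)
      ≤ ∫⁻ t in Set.Icc (-1 / h) (1 / h), ENNReal.ofReal ((s.card : ℝ)⁻¹ * R) := by
        refine setLIntegral_mono measurable_const fun t ht => ?_
        have ht' : |t| ≤ 1 / h := by rw [abs_le, ← neg_div]; exact ht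
        simp only [div_eq_mul_inv, enorm_mul, mul_pow]
        rw [lintegral_mul_const' _ _ (by simp), ENNReal.ofReal_mul (by positivity)]
        gcongr
        · exact lintegral_enorm_empCF_sub_sq_le _ hs t
        · rw [← ofReal_norm, ← ENNReal.ofReal_pow (norm_nonneg _), norm_inv]
          exact ENNReal.ofReal_le_ofReal (hR t ht')
    _ = _ := by
        rw [setLIntegral_const, Real.volume_Icc, ← ENNReal.ofReal_mul (by positivity)]
        congr 1
        ring

theorem truncAtomEstimator_le (φZ : ℝ → ℂ) (φu : ℝ → ℝ) (g : ℝ) (φemp : ℝ → ℂ) {ε : ℝ}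
    (hε : ε ≤ 1) : truncAtomEstimator φZ φu g ε φemp ≤ 1 - ε :=
  max_le (by linarith) (min_le_right _ _)

theorem le_truncAtomEstimator (φZ : ℝ → ℂ) (φu : ℝ → ℝ) (g : ℝ) (φemp : ℝ → ℂ) (ε : ℝ) :
    -1 + ε ≤ truncAtomEstimator φZ φu g ε φemp := le_max_left _ _

/-- Clipping to an interval containing `p` never increases the distance to `p`. The lower end is at
most `0 ≤ p`; the upper end can lie below `p`, and the overshoot is added. -/
theorem abs_truncAtomEstimator_sub_le (φZ : ℝ → ℂ) (φu : ℝ → ℝ) (g : ℝ) (φemp : ℝ → ℂ) {ε : ℝ}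
    (hε : ε ≤ 1) (h0 : 0 ≤ p) :
    |truncAtomEstimator φZ φu g ε φemp - p| ≤
      |atomEstimator φZ φu g φemp - p| + max 0 (p - (1 - ε)) := by
  unfold truncAtomEstimator
  set a := atomEstimator φZ φu g φemp
  rcases max_cases (-1 + ε) (min a (1 - ε)) with ⟨h1, h2⟩ | ⟨h1, h2⟩ <;>
  rcases min_cases a (1 - ε) with ⟨h3, h4⟩ | ⟨h3, h4⟩ <;>
  rcases max_cases 0 (p - (1 - ε)) with ⟨h5, h6⟩ | ⟨h5, h6⟩ <;>
  rw [h1, h5] <;> rw [abs_le] <;>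
  have := neg_abs_le (a - p) <;> have := le_abs_self (a - p) <;>
  constructor <;> linarith

theorem measurable_truncAtomEstimator (hk : IsProbDensity k) (hne : ∀ t, densityCF k t ≠ 0)
    (hu : IsAtomKernelFT φu α) (hg : 0 < g) (ε : ℝ) {n : ℕ} (s : Finset (Fin n)) :
    Measurable fun X : Fin n → ℝ =>
      truncAtomEstimator (densityCF k) φu g ε (empCF X s) := by
  have := measurable_atomEstimator hk hne hu hg s
  unfold truncAtomEstimator
  fun_prop

/-- The relative error of an estimated atom. -/
def atomError (p q : ℝ) : ℝ := (q - p) / (1 - q)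

theorem inv_one_sub_le (hL : 1 ≤ L) (hq : q ≤ 1 - L⁻¹) : (1 - q)⁻¹ ≤ L := by
  have hL0 : 0 < L⁻¹ := by positivity
  rw [inv_le_comm₀ (by linarith) (by linarith)]
  linarith

/-- As `(1 - p) / (1 - q) = 1 + atomError p q`, a mean-square bound on the relative error controls
the mean of `(1 - q)⁻²` without a logarithm. This is what sample splitting exploits. -/
theorem inv_one_sub_sq_le (hδ : 0 < δ) (hp : p ≤ 1 - δ) (hq : q < 1) :
    ((1 - q)⁻¹) ^ 2 ≤ 2 / δ ^ 2 * (1 + atomError p q ^ 2) := by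
  have h1 : (1 - q)⁻¹ = (1 - p)⁻¹ * (1 + atomError p q) := by
    have : 1 - q ≠ 0 := by linarith
    have : 1 - p ≠ 0 := by linarith
    rw [atomError]
    field_simp
    ring
  have h2 : ((1 - p)⁻¹) ^ 2 ≤ (δ⁻¹) ^ 2 := by
    have : δ ≤ 1 - p := by linarith
    have : 0 < 1 - p := by linarith
    gcongr
  rw [h1, mul_pow]
  calc ((1 - p)⁻¹) ^ 2 * (1 + atomError p q) ^ 2
      ≤ (δ⁻¹) ^ 2 * (2 * (1 + atomError p q ^ 2)) := by
        gcongr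
        nlinarith [sq_nonneg (1 - atomError p q)]
    _ = _ := by field_simp

theorem atomError_sq_le (hL : 1 ≤ L) (hq : q ≤ 1 - L⁻¹) :
    atomError p q ^ 2 ≤ L ^ 2 * (q - p) ^ 2 := by
  have hL0 : 0 < L⁻¹ := by positivity
  have : (0 : ℝ) ≤ (1 - q)⁻¹ := by rw [inv_nonneg]; linarith
  rw [atomError, div_eq_mul_inv, mul_pow, mul_comm]
  gcongr
  exact inv_one_sub_le hL hq

/-- Bound for the error of the truncated estimator of the atom with a logarithmic loss;
`a` is the untruncated estimator and `m` its mean. -/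
theorem atomError_sq_le_of_log {a m b : ℝ} (hL : 1 ≤ L) (hq : q ≤ 1 - L⁻¹)
    (hp : p ≤ 1 - δ) (hp1 : p ≤ 1)
    (hqa : |q - p| ≤ |a - p| + max 0 (p - (1 - L⁻¹))) (hb : (m - p) ^ 2 ≤ b) :
    atomError p q ^ 2 ≤ L ^ 2 * (4 * b + if δ < L⁻¹ then 2 else 0) + 4 * L ^ 2 * (a - m) ^ 2 := by
  have hLi : L⁻¹ ≤ 1 := inv_le_one_of_one_le₀ hL
  -- The overshoot can occur only while `L⁻¹ > δ`, hence for finitely many `n` when `L = log (3n)`.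
  have h1 : max 0 (p - (1 - L⁻¹)) ^ 2 ≤ if δ < L⁻¹ then 1 else 0 := by
    split_ifs with hi
    · exact pow_le_one₀ (le_max_left _ _) (max_le (by norm_num) (by linarith))
    · rw [max_eq_left (by linarith)]; norm_num
  have h2 : (q - p) ^ 2 ≤ 2 * (a - p) ^ 2 + 2 * max 0 (p - (1 - L⁻¹)) ^ 2 := by
    rw [← sq_abs (q - p), ← sq_abs (a - p)]
    have : |q - p| ^ 2 ≤ (|a - p| + max 0 (p - (1 - L⁻¹))) ^ 2 := by gcongr
    nlinarith [sq_nonneg (|a - p| - max 0 (p - (1 - L⁻¹)))]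
  have h3 : (a - p) ^ 2 ≤ 2 * (a - m) ^ 2 + 2 * (m - p) ^ 2 := by
    nlinarith [sq_nonneg ((a - m) - (m - p))]
  have h4 : (if δ < L⁻¹ then (2 : ℝ) else 0) = 2 * if δ < L⁻¹ then 1 else 0 := by
    split_ifs <;> norm_num
  calc atomError p q ^ 2 ≤ L ^ 2 * (q - p) ^ 2 := atomError_sq_le hL hq
    _ ≤ L ^ 2 * (4 * b + (if δ < L⁻¹ then 2 else 0) + 4 * (a - m) ^ 2) := by
      gcongr
      rw [h4]
      linarith
    _ = _ := by ring

/-- Bound for the error of the truncated estimator of the atom without loss in the bias term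
once the bias is small; `a` is the untruncated estimator and `m` its mean. -/
theorem atomError_sq_le_of_bias {a m b : ℝ} (hδ : 0 < δ) (hL : 1 ≤ L) (hq : q ≤ 1 - L⁻¹)
    (hq' : -1 + L⁻¹ ≤ q) (h0 : 0 ≤ p) (hp : p ≤ 1 - δ)
    (hqa : |q - p| ≤ |a - p| + max 0 (p - (1 - L⁻¹))) (hb : (m - p) ^ 2 ≤ b) :
    atomError p q ^ 2 ≤ (8 / δ ^ 2 * b + 4 * L ^ 2 * if δ < L⁻¹ ∨ δ ^ 2 / 16 < b then 1 else 0) +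
      (8 / δ ^ 2 + 4 * L ^ 2) * (a - m) ^ 2 := by
  have hL0 : 0 < L⁻¹ := by positivity
  have hb0 : 0 ≤ b := (sq_nonneg _).trans hb
  split_ifs with hi
  -- In the exceptional case only `|q - p| ≤ 2` is used.
  · have h1 : (q - p) ^ 2 ≤ 4 := by nlinarith
    calc atomError p q ^ 2 ≤ L ^ 2 * (q - p) ^ 2 := atomError_sq_le hL hq
      _ ≤ L ^ 2 * 4 := by gcongr
      _ ≤ _ := by
        have : 0 ≤ 8 / δ ^ 2 * b := by positivity
        have : 0 ≤ (8 / δ ^ 2 + 4 * L ^ 2) * (a - m) ^ 2 := by positivity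
        linarith
  · push Not at hi
    obtain ⟨hi1, hi2⟩ := hi
    rw [max_eq_left (by linarith), add_zero] at hqa
    have hmp : |m - p| ≤ δ / 4 := abs_le_of_sq_le_sq (by nlinarith) (by linarith)
    have htri : |a - p| ≤ |a - m| + |m - p| := abs_sub_le a m p
    -- With a small deviation, `|q - p| ≤ δ/2` and `1 - q ≥ δ/2`, so no `L` appears. With a large
    -- one, `|m - p| ≤ δ/4 < |a - m|`, so `|q - p| ≤ 2 |a - m|` and the factor `L²` falls on the
    -- variance only.
    by_cases hD : |a - m| ≤ δ / 4
    · have h1 : δ / 2 ≤ 1 - q := by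
        have := le_abs_self (q - p)
        linarith
      have h2 : (q - p) ^ 2 ≤ 2 * ((a - m) ^ 2 + b) := by
        have : (q - p) ^ 2 ≤ (|a - m| + |m - p|) ^ 2 := by
          rw [← sq_abs (q - p)]
          gcongr
          linarith
        nlinarith [sq_nonneg (|a - m| - |m - p|), sq_abs (a - m), sq_abs (m - p)]
      calc atomError p q ^ 2 = (q - p) ^ 2 / (1 - q) ^ 2 := by rw [atomError, div_pow]
        _ ≤ 2 * ((a - m) ^ 2 + b) / (δ / 2) ^ 2 := by gcongr
        _ = 8 / δ ^ 2 * b + 8 / δ ^ 2 * (a - m) ^ 2 := by field_simp; ring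
        _ ≤ _ := by
          have : 0 ≤ 4 * L ^ 2 * (a - m) ^ 2 := by positivity
          linarith
    · push Not at hD
      have h2 : (q - p) ^ 2 ≤ 4 * (a - m) ^ 2 := by
        have : (q - p) ^ 2 ≤ (2 * |a - m|) ^ 2 := by
          rw [← sq_abs (q - p)]
          gcongr
          linarith
        rwa [mul_pow, sq_abs, show (2 : ℝ) ^ 2 = 4 by norm_num] at this
      calc atomError p q ^ 2 ≤ L ^ 2 * (q - p) ^ 2 := atomError_sq_le hL hq
        _ ≤ L ^ 2 * (4 * (a - m) ^ 2) := by gcongr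
        _ ≤ _ := by
          have : 0 ≤ 8 / δ ^ 2 * b := by positivity
          have : 0 ≤ 8 / δ ^ 2 * (a - m) ^ 2 := by positivity
          linarith

theorem lintegral_const_add_mul_le {Ω : Type*} [MeasurableSpace Ω] (P : Measure Ω)
    [IsProbabilityMeasure P] {F D : Ω → ℝ} {c₀ c₁ V : ℝ} (h₀ : 0 ≤ c₀) (h₁ : 0 ≤ c₁)
    (hV : 0 ≤ V) (hF : ∀ ω, F ω ≤ c₀ + c₁ * D ω) (hD : ∀ ω, 0 ≤ D ω)
    (hDV : ∫⁻ ω, ENNReal.ofReal (D ω) ∂P ≤ ENNReal.ofReal V) :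
    ∫⁻ ω, ENNReal.ofReal (F ω) ∂P ≤ ENNReal.ofReal (c₀ + c₁ * V) := by
  calc ∫⁻ ω, ENNReal.ofReal (F ω) ∂P
      ≤ ∫⁻ ω, (ENNReal.ofReal c₀ + ENNReal.ofReal c₁ * ENNReal.ofReal (D ω)) ∂P := by
        refine lintegral_mono fun ω => ?_
        rw [← ENNReal.ofReal_mul h₁, ← ENNReal.ofReal_add h₀ (mul_nonneg h₁ (hD ω))]
        exact ENNReal.ofReal_le_ofReal (hF ω)
    _ = ENNReal.ofReal c₀ + ENNReal.ofReal c₁ * ∫⁻ ω, ENNReal.ofReal (D ω) ∂P := by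
        rw [lintegral_add_left measurable_const, lintegral_const_mul' _ _ ENNReal.ofReal_ne_top,
          lintegral_const, measure_univ, mul_one]
    _ ≤ ENNReal.ofReal c₀ + ENNReal.ofReal c₁ * ENNReal.ofReal V := by gcongr
    _ = _ := by
        rw [← ENNReal.ofReal_mul h₁, ← ENNReal.ofReal_add h₀ (by positivity)]

end

/-! ### Worst-case risk bounds for fixed sample size and bandwidths. -/

noncomputable section

variable {α K W U p q h g R Rg L δ pstar : ℝ} {f k φu φw : ℝ → ℝ}

/-- The bound for the squared bias of the estimator of the atom. -/
def atomBias (α K U g : ℝ) : ℝ := U ^ 2 * K * (g * g ^ (2 * α))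

/-- The bound for the variance of the estimator of the atom based on `m` observations. -/
def atomVariance (k : ℝ → ℝ) (U R g : ℝ) (m : ℕ) : ℝ :=
  (m : ℝ)⁻¹ * (g * U ^ 2 * R * ∫ t, ‖densityCF k t‖)

theorem atomBias_nonneg (hK : 0 < K) (hg : 0 < g) : 0 ≤ atomBias α K U g := by
  unfold atomBias; positivity

theorem atomVariance_nonneg (k : ℝ → ℝ) (U : ℝ) (hR : 0 ≤ R) (hg : 0 < g) (m : ℕ) :
    0 ≤ atomVariance k U R g m := by
  unfold atomVariance
  have : 0 ≤ ∫ t, ‖densityCF k t‖ := integral_nonneg fun t => norm_nonneg _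
  positivity

/-- The estimated atom and the empirical characteristic function share the sample, so `(1 - q)⁻²` is
replaced by its deterministic bound `L²` in the stochastic term. -/
theorem worstMise_fullEstimator_le (hα : 0 < α) (hK : 0 < K) (hpstar : pstar < 1)
    (hk : IsProbDensity k) (hne : ∀ t, densityCF k t ≠ 0) (hint : Integrable (densityCF k))
    (hu : IsAtomKernelFT φu α) (hw : IsDensityKernelFT φw α)
    (hU : ∀ t, |φu t| ≤ U * |t| ^ α) (hW0 : 0 < W) (hW : ∀ t, |φw t - 1| ≤ W * |t| ^ α)
    {n : ℕ} (hn : 0 < n) (hL : 1 ≤ L) (hh : 0 < h)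
    (hR : ∀ t, |t| ≤ 1 / h → (‖densityCF k t‖⁻¹) ^ 2 ≤ R) :
    worstMise n α K pstar k (fullEstimator (densityCF k) φu φw n h h L⁻¹) ≤
      ENNReal.ofReal ((1 + W) ^ 2 * L ^ 2 * ((n : ℝ)⁻¹ * (R * (2 / h))) +
        8 * (1 + W) ^ 2 / h * ((8 / (1 - pstar) ^ 2 * atomBias α K U h +
          4 * L ^ 2 * if 1 - pstar < L⁻¹ ∨ (1 - pstar) ^ 2 / 16 < atomBias α K U h
            then 1 else 0) +
          (8 / (1 - pstar) ^ 2 + 4 * L ^ 2) * atomVariance k U R h n) +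
        W ^ 2 * h ^ (2 * α) * K) := by
  have hR0 : 0 ≤ R := (sq_nonneg _).trans (hR 0 (by simp; positivity))
  have hδ : 0 < 1 - pstar := sub_pos.2 hpstar
  have hLi : L⁻¹ ≤ 1 := inv_le_one_of_one_le₀ hL
  have hL0 : 0 < L⁻¹ := by positivity
  have hb0 := atomBias_nonneg (α := α) (U := U) hK hh
  have hV0 := atomVariance_nonneg k U hR0 hh n
  refine iSup₂_le fun f hf => iSup₂_le fun p hp => ?_
  obtain ⟨h0, hp1⟩ := hp
  have h1 : p < 1 := hp1.trans_lt hpstar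
  have hP := isProbabilityMeasure_sampleLaw h0 h1.le hf.1 hk n
  have hs : (Finset.univ : Finset (Fin n)).Nonempty :=
    Finset.univ_nonempty_iff.2 ⟨⟨0, hn⟩⟩
  have hcard : (Finset.univ : Finset (Fin n)).card = n := by simp
  set c₀ := 8 / (1 - pstar) ^ 2 * atomBias α K U h +
          4 * L ^ 2 * if 1 - pstar < L⁻¹ ∨ (1 - pstar) ^ 2 / 16 < atomBias α K U h
            then 1 else 0 with hc₀
  set c₁ := 8 / (1 - pstar) ^ 2 + 4 * L ^ 2 with hc₁
  have hc₀0 : 0 ≤ c₀ := by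
    rw [hc₀]
    split_ifs <;> positivity
  have hc₁0 : 0 ≤ c₁ := by positivity
  set Q : (Fin n → ℝ) → ℝ := fun X =>
    truncAtomEstimator (densityCF k) φu h L⁻¹ (empCF X Finset.univ) with hQdef
  have hQm : Measurable Q := measurable_truncAtomEstimator hk hne hu hh _ _
  have hQ1 : ∀ X, Q X ≤ 1 - L⁻¹ := fun X => truncAtomEstimator_le _ _ _ _ hLi
  set H : (Fin n → ℝ) → ℝ≥0∞ := fun X => ∫⁻ t in Set.Icc (-1 / h) (1 / h),
    ‖(empCF X Finset.univ t - charFun (observationLaw p f k) t) / densityCF k t‖ₑ ^ 2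
  have hHm : Measurable H :=
    (measurable_empCF_error h0 h1.le hf.1 hk Finset.univ).lintegral_prod_right'
  have hH := lintegral_empCF_error_le h0 h1.le hf.1 hk hh hR hs
  have hD := lintegral_sq_atomEstimator_sub_le h0 h1.le hf.1 hk hne hint hα hu hh hU hR hs
  have hB := sq_integral_atomScore_sub_le h0 h1.le hf hK hk hne hu hh hU
  rw [hcard] at hH hD
  have hE : ∫⁻ X, ENNReal.ofReal (atomError p (Q X) ^ 2) ∂(sampleLaw n p f k) ≤
      ENNReal.ofReal (c₀ + c₁ * atomVariance k U R h n) :=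
    lintegral_const_add_mul_le _ hc₀0 hc₁0 hV0
      (fun X => atomError_sq_le_of_bias hδ hL (hQ1 X) (le_truncAtomEstimator _ _ _ _ _) h0
        (by linarith) (abs_truncAtomEstimator_sub_le _ _ _ _ hLi h0) hB)
      (fun X => sq_nonneg _) hD
  calc mise n p f k (fullEstimator (densityCF k) φu φw n h h L⁻¹)
      ≤ ∫⁻ X, (ENNReal.ofReal ((1 + W) ^ 2 * L ^ 2) * H X +
          ENNReal.ofReal (8 * (1 + W) ^ 2 / h) * ENNReal.ofReal (atomError p (Q X) ^ 2) +
          ENNReal.ofReal (W ^ 2 * h ^ (2 * α) * K)) ∂(sampleLaw n p f k) := by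
        refine lintegral_mono fun X => ?_
        have hq : Q X < 1 := (hQ1 X).trans_lt (by linarith)
        refine (lintegral_densityEstimator_sub_sq_le hα hf hk hne hw hW0 hW h0 h1 hh hq
          ((continuous_empCF Finset.univ).comp (Continuous.prodMk_right X))).trans ?_
        rw [ENNReal.ofReal_mul (p := 8 * (1 + W) ^ 2 / h) (by positivity)]
        gcongr ENNReal.ofReal ?_ * _ + _ + _
        have := inv_one_sub_le hL (hQ1 X)
        have : 0 ≤ (1 - Q X)⁻¹ := by rw [inv_nonneg]; linarith
        gcongr
    _ = ENNReal.ofReal ((1 + W) ^ 2 * L ^ 2) * (∫⁻ X, H X ∂(sampleLaw n p f k)) +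
          ENNReal.ofReal (8 * (1 + W) ^ 2 / h) *
            (∫⁻ X, ENNReal.ofReal (atomError p (Q X) ^ 2) ∂(sampleLaw n p f k)) +
          ENNReal.ofReal (W ^ 2 * h ^ (2 * α) * K) := by
        rw [lintegral_add_right _ measurable_const, lintegral_add_left (by fun_prop),
          lintegral_const_mul' _ _ ENNReal.ofReal_ne_top,
          lintegral_const_mul' _ _ ENNReal.ofReal_ne_top, lintegral_const, measure_univ, mul_one]
    _ ≤ ENNReal.ofReal ((1 + W) ^ 2 * L ^ 2) * ENNReal.ofReal ((n : ℝ)⁻¹ * (R * (2 / h))) +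
          ENNReal.ofReal (8 * (1 + W) ^ 2 / h) *
            ENNReal.ofReal (c₀ + c₁ * atomVariance k U R h n) +
          ENNReal.ofReal (W ^ 2 * h ^ (2 * α) * K) := by
        gcongr
    _ = _ := by
        rw [← ENNReal.ofReal_mul (by positivity), ← ENNReal.ofReal_mul (by positivity),
          ← ENNReal.ofReal_add (by positivity) (by positivity),
          ← ENNReal.ofReal_add (by positivity) (by positivity)]

/-- `E` stands for a bound on the mean squared relative error of the atom. Through independence it
also bounds the mean of `(1 - q)⁻²`, so the stochastic term carries `1 + E` in place of `L²`. -/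
theorem worstMise_splitEstimator_le (hα : 0 < α) (hK : 0 < K) (hpstar : pstar < 1)
    (hk : IsProbDensity k) (hne : ∀ t, densityCF k t ≠ 0) (hint : Integrable (densityCF k))
    (hu : IsAtomKernelFT φu α) (hw : IsDensityKernelFT φw α)
    (hU : ∀ t, |φu t| ≤ U * |t| ^ α) (hW0 : 0 < W) (hW : ∀ t, |φw t - 1| ≤ W * |t| ^ α)
    {n : ℕ} (hn : 2 ≤ n) (hL : 1 ≤ L) (hh : 0 < h) (hg : 0 < g)
    (hR : ∀ t, |t| ≤ 1 / h → (‖densityCF k t‖⁻¹) ^ 2 ≤ R)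
    (hRg : ∀ t, |t| ≤ 1 / g → (‖densityCF k t‖⁻¹) ^ 2 ≤ Rg) {E : ℝ}
    (hE : L ^ 2 * (4 * atomBias α K U g + if 1 - pstar < L⁻¹ then 2 else 0) +
      4 * L ^ 2 * atomVariance k U Rg g (n / 2) ≤ E) :
    worstMise n α K pstar k (splitEstimator (densityCF k) φu φw n h g L⁻¹) ≤
      ENNReal.ofReal ((1 + W) ^ 2 * (2 / (1 - pstar) ^ 2 * (1 + E)) *
          (((n - n / 2 : ℕ) : ℝ)⁻¹ * (R * (2 / h))) +
        8 * (1 + W) ^ 2 / h * E + W ^ 2 * h ^ (2 * α) * K) := by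
  have hR0 : 0 ≤ R := (sq_nonneg _).trans (hR 0 (by simp; positivity))
  have hRg0 : 0 ≤ Rg := (sq_nonneg _).trans (hRg 0 (by simp; positivity))
  have hδ : 0 < 1 - pstar := sub_pos.2 hpstar
  have hLi : L⁻¹ ≤ 1 := inv_le_one_of_one_le₀ hL
  have hL0 : 0 < L⁻¹ := by positivity
  have hb0 := atomBias_nonneg (α := α) (U := U) hK hg
  have hV0 := atomVariance_nonneg k U hRg0 hg (n / 2)
  refine iSup₂_le fun f hf => iSup₂_le fun p hp => ?_
  obtain ⟨h0, hp1⟩ := hp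
  have h1 : p < 1 := hp1.trans_lt hpstar
  have hμ := isProbabilityMeasure_observationLaw h0 h1.le hf.1 hk
  have hP := isProbabilityMeasure_sampleLaw h0 h1.le hf.1 hk n
  have hs : (firstHalf n).Nonempty := by
    rw [← Finset.card_pos, card_firstHalf]; omega
  have hs' : (secondHalf n).Nonempty := by
    rw [← Finset.card_pos, card_secondHalf]; omega
  set c₀ := L ^ 2 * (4 * atomBias α K U g + if 1 - pstar < L⁻¹ then 2 else 0) with hc₀
  set c₁ := 4 * L ^ 2 with hc₁
  have hc₀0 : 0 ≤ c₀ := by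
    rw [hc₀]
    split_ifs <;> positivity
  have hc₁0 : 0 ≤ c₁ := by positivity
  have hE0 : 0 ≤ E := le_trans (by positivity) hE
  set Q : (Fin n → ℝ) → ℝ := fun X =>
    truncAtomEstimator (densityCF k) φu g L⁻¹ (empCF X (firstHalf n)) with hQdef
  have hQm : Measurable Q := measurable_truncAtomEstimator hk hne hu hg _ _
  have hQ1 : ∀ X, Q X ≤ 1 - L⁻¹ := fun X => truncAtomEstimator_le _ _ _ _ hLi
  have hQlt : ∀ X, Q X < 1 := fun X => (hQ1 X).trans_lt (by linarith)
  set H : (Fin n → ℝ) → ℝ≥0∞ := fun X => ∫⁻ t in Set.Icc (-1 / h) (1 / h),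
    ‖(empCF X (secondHalf n) t - charFun (observationLaw p f k) t) / densityCF k t‖ₑ ^ 2
    with hHdef
  have hHm : Measurable H :=
    (measurable_empCF_error h0 h1.le hf.1 hk (secondHalf n)).lintegral_prod_right'
  have hH := lintegral_empCF_error_le h0 h1.le hf.1 hk hh hR hs'
  have hD := lintegral_sq_atomEstimator_sub_le h0 h1.le hf.1 hk hne hint hα hu hg hU hRg hs
  have hB := sq_integral_atomScore_sub_le h0 h1.le hf hK hk hne hu hg hU
  rw [card_secondHalf] at hH
  rw [card_firstHalf] at hD
  have hEQ : ∫⁻ X, ENNReal.ofReal (atomError p (Q X) ^ 2) ∂(sampleLaw n p f k) ≤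
      ENNReal.ofReal E :=
    (lintegral_const_add_mul_le _ hc₀0 hc₁0 hV0
      (fun X => atomError_sq_le_of_log hL (hQ1 X) (by linarith) h1.le
        (abs_truncAtomEstimator_sub_le _ _ _ _ hLi h0) hB)
      (fun X => sq_nonneg _) hD).trans (ENNReal.ofReal_le_ofReal hE)
  have hEI : ∫⁻ X, ENNReal.ofReal (((1 - Q X)⁻¹) ^ 2) ∂(sampleLaw n p f k) ≤
      ENNReal.ofReal (2 / (1 - pstar) ^ 2 + 2 / (1 - pstar) ^ 2 * E) :=
    lintegral_const_add_mul_le _ (by positivity) (by positivity) hE0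
      (fun X => (inv_one_sub_sq_le (p := p) hδ (by linarith) (hQlt X)).trans_eq (by ring))
      (fun X => sq_nonneg _) hEQ
  -- The estimated atom depends on the first half of the sample and `H` on the second.
  have hindep : ∫⁻ X, ENNReal.ofReal (((1 - Q X)⁻¹) ^ 2) * H X ∂(sampleLaw n p f k) =
      (∫⁻ X, ENNReal.ofReal (((1 - Q X)⁻¹) ^ 2) ∂(sampleLaw n p f k)) *
        ∫⁻ X, H X ∂(sampleLaw n p f k) :=
    lintegral_mul_of_disjoint _ (disjoint_firstHalf_secondHalf n) (by fun_prop) hHm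
      (fun X => by simp only [hQdef, empCF_extendZero])
      (fun X => by simp only [hHdef, empCF_extendZero])
  calc mise n p f k (splitEstimator (densityCF k) φu φw n h g L⁻¹)
      ≤ ∫⁻ X, (ENNReal.ofReal ((1 + W) ^ 2) * (ENNReal.ofReal (((1 - Q X)⁻¹) ^ 2) * H X) +
          ENNReal.ofReal (8 * (1 + W) ^ 2 / h) * ENNReal.ofReal (atomError p (Q X) ^ 2) +
          ENNReal.ofReal (W ^ 2 * h ^ (2 * α) * K)) ∂(sampleLaw n p f k) := by
        refine lintegral_mono fun X => ?_
        refine (lintegral_densityEstimator_sub_sq_le hα hf hk hne hw hW0 hW h0 h1 hh (hQlt X)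
          ((continuous_empCF (secondHalf n)).comp (Continuous.prodMk_right X))).trans_eq ?_
        rw [ENNReal.ofReal_mul (p := 8 * (1 + W) ^ 2 / h) (by positivity),
          ENNReal.ofReal_mul (p := (1 + W) ^ 2) (by positivity), mul_assoc]
        rfl
    _ = ENNReal.ofReal ((1 + W) ^ 2) *
          ((∫⁻ X, ENNReal.ofReal (((1 - Q X)⁻¹) ^ 2) ∂(sampleLaw n p f k)) *
            ∫⁻ X, H X ∂(sampleLaw n p f k)) +
          ENNReal.ofReal (8 * (1 + W) ^ 2 / h) *
            (∫⁻ X, ENNReal.ofReal (atomError p (Q X) ^ 2) ∂(sampleLaw n p f k)) +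
          ENNReal.ofReal (W ^ 2 * h ^ (2 * α) * K) := by
        rw [lintegral_add_right _ measurable_const, lintegral_add_left (by fun_prop),
          lintegral_const_mul' _ _ ENNReal.ofReal_ne_top, hindep,
          lintegral_const_mul' _ _ ENNReal.ofReal_ne_top, lintegral_const, measure_univ, mul_one]
    _ ≤ ENNReal.ofReal ((1 + W) ^ 2) *
          (ENNReal.ofReal (2 / (1 - pstar) ^ 2 + 2 / (1 - pstar) ^ 2 * E) *
            ENNReal.ofReal (((n - n / 2 : ℕ) : ℝ)⁻¹ * (R * (2 / h)))) +
          ENNReal.ofReal (8 * (1 + W) ^ 2 / h) * ENNReal.ofReal E +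
          ENNReal.ofReal (W ^ 2 * h ^ (2 * α) * K) := by
        gcongr
    _ = _ := by
        rw [← ENNReal.ofReal_mul (by positivity), ← ENNReal.ofReal_mul (by positivity),
          ← ENNReal.ofReal_mul (by positivity),
          ← ENNReal.ofReal_add (by positivity) (by positivity),
          ← ENNReal.ofReal_add (by positivity) (by positivity)]
        congr 1
        ring

end

/-! ### Domination of sequences, and bounds for `1/φ_Z` on the estimation band. -/

noncomputable section

/-- `a n ≤ C b n` for all `n ≥ 2`, with a constant `C ≥ 0`. -/
def Dominated (a b : ℕ → ℝ) : Prop := ∃ C, 0 ≤ C ∧ ∀ n, 2 ≤ n → a n ≤ C * b n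

namespace Dominated

variable {a a' b b' c : ℕ → ℝ}

theorem of_le {C : ℝ} (hC : 0 ≤ C) (h : ∀ n, 2 ≤ n → a n ≤ C * b n) : Dominated a b :=
  ⟨C, hC, h⟩

theorem trans (h : Dominated a b) (h' : Dominated b c) : Dominated a c := by
  obtain ⟨C, hC, h⟩ := h
  obtain ⟨C', hC', h'⟩ := h'
  refine ⟨C * C', mul_nonneg hC hC', fun n hn => (h n hn).trans ?_⟩
  rw [mul_assoc]
  exact mul_le_mul_of_nonneg_left (h' n hn) hC

theorem add (h : Dominated a b) (h' : Dominated a' b) :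
    Dominated (fun n => a n + a' n) b := by
  obtain ⟨C, hC, h⟩ := h
  obtain ⟨C', hC', h'⟩ := h'
  refine ⟨C + C', add_nonneg hC hC', fun n hn => ?_⟩
  rw [add_mul]
  exact add_le_add (h n hn) (h' n hn)

theorem const_mul (h : Dominated a b) {r : ℝ} (hr : 0 ≤ r) : Dominated (fun n => r * a n) b := by
  obtain ⟨C, hC, h⟩ := h
  refine ⟨r * C, mul_nonneg hr hC, fun n hn => ?_⟩
  rw [mul_assoc]
  exact mul_le_mul_of_nonneg_left (h n hn) hr

/-- The finitely many exceptional indices are covered by taking the sum of their ratios as the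
constant. This disposes of the indicator terms in the risk bounds. -/
theorem of_eventually_zero (h : ∀ᶠ n in atTop, a n = 0) (hb : ∀ n, 2 ≤ n → 0 < b n) :
    Dominated a b := by
  obtain ⟨N, hN⟩ := eventually_atTop.1 h
  refine ⟨∑ n ∈ Finset.range N, |a n| / |b n|, Finset.sum_nonneg fun n _ => by positivity,
    fun n hn => ?_⟩
  have hbn := hb n hn
  rcases lt_or_ge n N with hnN | hnN
  · have h1 : |a n| / |b n| ≤ ∑ n ∈ Finset.range N, |a n| / |b n| :=
      Finset.single_le_sum (f := fun n => |a n| / |b n|) (fun n _ => by positivity)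
        (Finset.mem_range.2 hnN)
    rw [abs_of_pos hbn, div_le_iff₀ hbn] at h1
    exact (le_abs_self _).trans h1
  · rw [hN n hnN]
    have : 0 ≤ ∑ n ∈ Finset.range N, |a n| / |b n| := Finset.sum_nonneg fun n _ => by positivity
    positivity

end Dominated

theorem log_two_le_log_natCast {n : ℕ} (hn : 2 ≤ n) : Real.log 2 ≤ Real.log n :=
  Real.log_le_log (by norm_num) (by exact_mod_cast hn)

theorem log_natCast_pos {n : ℕ} (hn : 2 ≤ n) : 0 < Real.log n :=
  (Real.log_pos (by norm_num)).trans_le (log_two_le_log_natCast hn)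

theorem one_le_log_three_mul {n : ℕ} (hn : 2 ≤ n) : 1 ≤ Real.log (3 * n) := by
  have hn' : (2 : ℝ) ≤ n := by exact_mod_cast hn
  rw [Real.le_log_iff_exp_le (by positivity)]
  linarith [Real.exp_one_lt_d9]

theorem log_three_mul_le {n : ℕ} (hn : 2 ≤ n) : Real.log (3 * n) ≤ 3 * Real.log n := by
  have hn' : (2 : ℝ) ≤ n := by exact_mod_cast hn
  rw [Real.log_mul (by norm_num) (by positivity)]
  have h1 : Real.log 3 ≤ Real.log 4 := Real.log_le_log (by norm_num) (by norm_num)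
  have h2 : Real.log 4 = 2 * Real.log 2 := by
    rw [show (4 : ℝ) = 2 ^ 2 by norm_num, Real.log_pow]; norm_num
  linarith [log_two_le_log_natCast hn]

theorem dominated_log_rpow_of_le {r s : ℝ} (hrs : r ≤ s) :
    Dominated (fun n => Real.log n ^ r) (fun n => Real.log n ^ s) := by
  have h2 : 0 < Real.log 2 := Real.log_pos (by norm_num)
  refine .of_le (C := Real.log 2 ^ (-(s - r))) (by positivity) fun n hn => ?_
  have hl := log_natCast_pos hn
  have h3 : Real.log n ^ r = Real.log n ^ (-(s - r)) * Real.log n ^ s := by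
    rw [← Real.rpow_add hl]; congr 1; ring
  have h4 : Real.log n ^ (-(s - r)) ≤ Real.log 2 ^ (-(s - r)) :=
    Real.rpow_le_rpow_of_nonpos h2 (log_two_le_log_natCast hn) (by linarith)
  rw [h3]
  gcongr

theorem dominated_log_rpow (r : ℝ) {s : ℝ} (hs : 0 < s) :
    Dominated (fun n => Real.log n ^ r) (fun n => (n : ℝ) ^ s) := by
  -- Passing to `max r 1` makes the exponent positive, so that the budget `s` can be divided by it.
  refine (dominated_log_rpow_of_le (le_max_left r 1)).trans ?_
  have hr : 0 < max r 1 := by positivity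
  refine .of_le (C := ((s / max r 1) ^ max r 1)⁻¹) (by positivity) fun n hn => ?_
  have hl := log_natCast_pos hn
  have h1 := Real.log_le_rpow_div (Nat.cast_nonneg n) (by positivity : 0 < s / max r 1)
  calc Real.log n ^ max r 1 ≤ ((n : ℝ) ^ (s / max r 1) / (s / max r 1)) ^ max r 1 := by gcongr
    _ = _ := by
      rw [Real.div_rpow (by positivity) (by positivity), ← Real.rpow_mul (by positivity),
        div_mul_cancel₀ _ hr.ne', div_eq_inv_mul]

theorem dominated_log_three_mul_sq :
    Dominated (fun n => Real.log (3 * n) ^ 2) (fun n => Real.log n ^ (2 : ℝ)) := by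
  refine .of_le (C := 9) (by norm_num) fun n hn => ?_
  have h1 := one_le_log_three_mul hn
  have h2 := log_three_mul_le hn
  rw [Real.rpow_two]
  nlinarith

theorem tendsto_inv_log_three_mul :
    Tendsto (fun n : ℕ => (Real.log (3 * n))⁻¹) atTop (𝓝 0) :=
  tendsto_inv_atTop_zero.comp (Real.tendsto_log_atTop.comp
    (tendsto_natCast_atTop_atTop.const_mul_atTop (by norm_num)))

/-- Continuity and absence of zeros bound `1/F` on a ball; outside it the tail bound holds. The
radius is at least 1, so that `1 ≤ |t|` is available for comparing powers. Leaving `lb` abstract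
serves both smoothness classes. -/
theorem exists_inv_norm_le_or {lb : ℝ → ℂ → Prop} {F : ℝ → ℂ} (hF : Continuous F)
    (hne : ∀ t, F t ≠ 0) (h : ∀ᶠ t in cocompact ℝ, lb t (F t)) :
    ∃ c, 0 ≤ c ∧ ∀ t, ‖F t‖⁻¹ ≤ c ∨ (1 ≤ |t| ∧ lb t (F t)) := by
  rw [← Metric.cobounded_eq_cocompact,
    (Metric.hasBasis_cobounded_compl_closedBall 0).eventually_iff] at h
  obtain ⟨T, -, hT⟩ := h
  obtain ⟨c, hc⟩ := (isCompact_closedBall (0 : ℝ) (max T 1)).exists_bound_of_continuousOn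
    (hF.continuousOn.inv₀ fun t _ => hne t)
  have h0 : (0 : ℝ) ∈ Metric.closedBall (0 : ℝ) (max T 1) := by simp
  refine ⟨c, (norm_nonneg _).trans (hc 0 h0), fun t => ?_⟩
  by_cases ht : t ∈ Metric.closedBall (0 : ℝ) (max T 1)
  · left
    have := hc t ht
    rwa [Pi.inv_apply, norm_inv] at this
  · right
    refine ⟨?_, hT fun ht' => ht (Metric.closedBall_subset_closedBall (le_max_left _ _) ht')⟩
    rw [Metric.mem_closedBall, dist_zero_right, Real.norm_eq_abs, not_le] at ht
    exact (le_max_right _ _).trans ht.le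

theorem OrdinarySmooth.exists_inv_norm_sq_le {φZ : ℝ → ℂ} {β : ℝ} (h : OrdinarySmooth φZ β)
    (hc : Continuous φZ) (hβ : 0 < β) {h₀ : ℝ} (hh₀ : 0 < h₀) :
    ∃ C, 0 ≤ C ∧ ∀ h, 0 < h → h ≤ h₀ → ∀ t, |t| ≤ 1 / h →
      (‖φZ t‖⁻¹) ^ 2 ≤ C * h ^ (-(2 * β)) := by
  obtain ⟨d₀, hd₀, hlb⟩ := h.lower_bound
  obtain ⟨c, hc0, hcb⟩ := exists_inv_norm_le_or (lb := fun t z => d₀ * |t| ^ (-β) ≤ ‖z‖) hc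
    h.ne_zero hlb
  refine ⟨(c * h₀ ^ β + d₀⁻¹) ^ 2, by positivity, fun h hh hle t ht => ?_⟩
  have e : h ^ (-(2 * β)) = (h ^ (-β)) ^ 2 := by
    rw [← Real.rpow_natCast, ← Real.rpow_mul hh.le]; congr 1; push_cast; ring
  rw [e, ← mul_pow]
  gcongr
  -- The restriction `h ≤ h₀` lets the constant from the compact part be absorbed into `h ^ (-β)`.
  have h1 : 1 ≤ h₀ ^ β * h ^ (-β) := by
    rw [Real.rpow_neg hh.le, ← div_eq_mul_inv, one_le_div (by positivity)]
    gcongr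
  rcases hcb t with h2 | ⟨h2, h3⟩
  · calc ‖φZ t‖⁻¹ ≤ c := h2
      _ ≤ c * (h₀ ^ β * h ^ (-β)) := le_mul_of_one_le_right hc0 h1
      _ ≤ (c * h₀ ^ β + d₀⁻¹) * h ^ (-β) := by
        rw [add_mul, ← mul_assoc]
        exact le_add_of_nonneg_right (by positivity)
  · have ht0 : 0 < |t| := by linarith
    calc ‖φZ t‖⁻¹ ≤ (d₀ * |t| ^ (-β))⁻¹ := by gcongr
      _ = d₀⁻¹ * |t| ^ β := by rw [mul_inv, Real.rpow_neg (abs_nonneg _), inv_inv]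
      _ ≤ d₀⁻¹ * (1 / h) ^ β := by gcongr
      _ = d₀⁻¹ * h ^ (-β) := by rw [one_div, Real.inv_rpow hh.le, Real.rpow_neg hh.le]
      _ ≤ (c * h₀ ^ β + d₀⁻¹) * h ^ (-β) := by
        gcongr
        exact le_add_of_nonneg_left (by positivity)

/-- The bandwidth gives `|t|^β ≤ (γ/4) log n`, so `exp (|t|^β / γ) ≤ n^(1/4)`. Squaring costs
`n^(1/2)`, which leaves `n^(-1/2)` in every variance, while `|t|^(-β₀)` costs only a power of the
logarithm. -/
theorem Supersmooth.exists_inv_norm_sq_le {φZ : ℝ → ℂ} {β γ : ℝ} (h : Supersmooth φZ β γ)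
    (hc : Continuous φZ) (hβ : 0 < β) (hγ : 0 < γ) :
    ∃ C s : ℝ, 0 ≤ C ∧ 0 ≤ s ∧ ∀ n : ℕ, 2 ≤ n →
      ∀ t, |t| ≤ 1 / ((4 / γ) ^ (1 / β) * Real.log n ^ (-(1 / β))) →
      (‖φZ t‖⁻¹) ^ 2 ≤ C * (Real.log n ^ s * (n : ℝ) ^ (1 / 2 : ℝ)) := by
  obtain ⟨d₀, β₀, hd₀, hlb⟩ := h.lower_bound
  obtain ⟨c, hc0, hcb⟩ := exists_inv_norm_le_or
    (lb := fun t z => d₀ * |t| ^ β₀ * Real.exp (-|t| ^ β / γ) ≤ ‖z‖) hc h.ne_zero hlb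
  have h2pos : 0 < Real.log 2 := Real.log_pos (by norm_num)
  set s := |β₀| / β
  set κ := ((γ / 4) ^ (1 / β)) ^ |β₀|
  refine ⟨(c * Real.log 2 ^ (-s) + d₀⁻¹ * κ) ^ 2, 2 * s, by positivity, by positivity,
    fun n hn t ht => ?_⟩
  have hl := log_natCast_pos hn
  have hn0 : (0 : ℝ) < n := by positivity
  have hn1 : (1 : ℝ) ≤ n := by exact_mod_cast (by omega : 1 ≤ n)
  have hT : 1 / ((4 / γ) ^ (1 / β) * Real.log n ^ (-(1 / β))) =
      (γ / 4 * Real.log n) ^ (1 / β) := by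
    rw [Real.mul_rpow (by positivity) hl.le, Real.rpow_neg hl.le, one_div, mul_inv, inv_inv,
      ← Real.inv_rpow (by positivity), inv_div]
  rw [hT] at ht
  have e : Real.log n ^ (2 * s) * (n : ℝ) ^ (1 / 2 : ℝ) =
      (Real.log n ^ s * (n : ℝ) ^ (1 / 4 : ℝ)) ^ 2 := by
    rw [mul_pow, ← Real.rpow_natCast (Real.log n ^ s), ← Real.rpow_mul hl.le,
      ← Real.rpow_natCast ((n : ℝ) ^ (1 / 4 : ℝ)), ← Real.rpow_mul hn0.le]
    congr 2
    · push_cast; ring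
    · push_cast; norm_num
  rw [e, ← mul_pow]
  gcongr
  have hn4 : 1 ≤ (n : ℝ) ^ (1 / 4 : ℝ) := Real.one_le_rpow hn1 (by norm_num)
  rcases hcb t with h2 | ⟨h2, h3⟩
  · have h4 : 1 ≤ Real.log 2 ^ (-s) * Real.log n ^ s := by
      rw [Real.rpow_neg h2pos.le, ← div_eq_inv_mul, one_le_div (by positivity)]
      have := log_two_le_log_natCast hn
      gcongr
    calc ‖φZ t‖⁻¹ ≤ c := h2
      _ ≤ c * (Real.log 2 ^ (-s) * Real.log n ^ s * (n : ℝ) ^ (1 / 4 : ℝ)) :=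
        le_mul_of_one_le_right hc0 (one_le_mul_of_one_le_of_one_le h4 hn4)
      _ = c * Real.log 2 ^ (-s) * (Real.log n ^ s * (n : ℝ) ^ (1 / 4 : ℝ)) := by ring
      _ ≤ _ := by
        gcongr
        exact le_add_of_nonneg_right (by positivity)
  · have ht0 : 0 < |t| := by linarith
    have h5 : Real.exp (|t| ^ β / γ) ≤ (n : ℝ) ^ (1 / 4 : ℝ) := by
      rw [Real.rpow_def_of_pos hn0]
      refine Real.exp_le_exp.2 ?_
      have : |t| ^ β ≤ γ / 4 * Real.log n := by
        calc |t| ^ β ≤ ((γ / 4 * Real.log n) ^ (1 / β)) ^ β := by gcongr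
          _ = γ / 4 * Real.log n := by
            rw [← Real.rpow_mul (by positivity), one_div_mul_cancel hβ.ne', Real.rpow_one]
      rw [div_le_iff₀ hγ]
      linarith
    have h6 : |t| ^ (-β₀) ≤ κ * Real.log n ^ s := by
      -- The sign of `β₀` is arbitrary; `1 ≤ |t|` permits this replacement.
      calc |t| ^ (-β₀) ≤ |t| ^ |β₀| := by
            apply Real.rpow_le_rpow_of_exponent_le h2 (neg_le_abs β₀)
        _ ≤ ((γ / 4 * Real.log n) ^ (1 / β)) ^ |β₀| := by gcongr
        _ = _ := by
          rw [Real.mul_rpow (by positivity) hl.le, Real.mul_rpow (by positivity) (by positivity),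
            ← Real.rpow_mul hl.le]
          congr 2
          simp only [s]
          ring
    calc ‖φZ t‖⁻¹ ≤ (d₀ * |t| ^ β₀ * Real.exp (-|t| ^ β / γ))⁻¹ := by gcongr
      _ = d₀⁻¹ * |t| ^ (-β₀) * Real.exp (|t| ^ β / γ) := by
        rw [mul_inv, mul_inv, Real.rpow_neg (abs_nonneg _), ← Real.exp_neg, neg_div, neg_neg]
      _ ≤ d₀⁻¹ * (κ * Real.log n ^ s) * (n : ℝ) ^ (1 / 4 : ℝ) := by gcongr
      _ = d₀⁻¹ * κ * (Real.log n ^ s * (n : ℝ) ^ (1 / 4 : ℝ)) := by ring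
      _ ≤ _ := by
        gcongr
        exact le_add_of_nonneg_left (by positivity)

end

/-! ### Rate in the supersmooth case. -/

noncomputable section

variable {α K pstar : ℝ} {k φu φw : ℝ → ℝ}

theorem exists_const_of_dominated {M : ℕ → ℝ≥0∞} {a b : ℕ → ℝ} (h : Dominated a b)
    (ha : ∀ n, 2 ≤ n → M n ≤ ENNReal.ofReal (a n)) :
    ∃ C : ℝ, ∀ n, 2 ≤ n → M n ≤ ENNReal.ofReal (C * b n) := by
  obtain ⟨C, -, hC⟩ := h
  exact ⟨C, fun n hn => (ha n hn).trans (ENNReal.ofReal_le_ofReal (hC n hn))⟩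

theorem worstMise_fullEstimator_supersmooth (hα : 0 < α) (hK : 0 < K) (hpstar : pstar < 1)
    (hk : IsProbDensity k) (hu : IsAtomKernelFT φu α) (hw : IsDensityKernelFT φw α)
    {β γ : ℝ} (hβ : 0 < β) (hγ : 0 < γ) (hZ : Supersmooth (densityCF k) β γ) :
    ∃ C : ℝ, ∀ n : ℕ, 2 ≤ n →
      worstMise n α K pstar k
          (fullEstimator (densityCF k) φu φw n
            ((4 / γ) ^ (1 / β) * Real.log n ^ (-(1 / β)))
            ((4 / γ) ^ (1 / β) * Real.log n ^ (-(1 / β)))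
            (Real.log (3 * n))⁻¹)
        ≤ ENNReal.ofReal (C * Real.log n ^ (-(2 * α / β))) := by
  obtain ⟨U, hU0, hU⟩ := hu.bound
  obtain ⟨W, hW0, hW⟩ := hw.bound
  obtain ⟨c, s, hc0, hs0, hR⟩ := hZ.exists_inv_norm_sq_le (continuous_densityCF hk) hβ hγ
  set κ := (4 / γ) ^ (1 / β) with hκ
  have hκ0 : 0 < κ := by positivity
  set δ := 1 - pstar with hδdef
  have hδ : 0 < δ := sub_pos.2 hpstar
  set h : ℕ → ℝ := fun n => κ * Real.log n ^ (-(1 / β)) with hh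
  set R : ℕ → ℝ := fun n => c * (Real.log n ^ s * (n : ℝ) ^ (1 / 2 : ℝ)) with hRdef
  set Z := ∫ t, ‖densityCF k t‖ with hZdef
  have hZ0 : 0 ≤ Z := integral_nonneg fun t => norm_nonneg _
  have hh0 : ∀ n, 2 ≤ n → 0 < h n := fun n hn => by
    have := log_natCast_pos hn
    positivity
  refine exists_const_of_dominated ?_ fun n hn =>
    worstMise_fullEstimator_le hα hK hpstar hk hZ.ne_zero hZ.integrable hu hw hU hW0 hW
      (by omega) (one_le_log_three_mul hn) (hh0 n hn) (hR n hn)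
  have hpos : ∀ n : ℕ, 2 ≤ n → 0 < Real.log n ^ (-(2 * α / β)) := fun n hn =>
    Real.rpow_pos_of_pos (log_natCast_pos hn) _
  have hlog0 : ∀ (r : ℝ) (n : ℕ), 2 ≤ n → 0 ≤ Real.log n ^ r := fun r n hn =>
    (Real.rpow_pos_of_pos (log_natCast_pos hn) _).le
  have hpow : ∀ n, 2 ≤ n → h n ^ (2 * α) = κ ^ (2 * α) * Real.log n ^ (-(2 * α / β)) := by
    intro n hn
    have hl := log_natCast_pos hn
    simp only [hh]
    rw [Real.mul_rpow hκ0.le (by positivity), ← Real.rpow_mul hl.le]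
    congr 2
    ring
  have dpow : Dominated (fun n => h n ^ (2 * α)) (fun n => Real.log n ^ (-(2 * α / β))) :=
    .of_le (C := κ ^ (2 * α)) (by positivity) fun n hn => (hpow n hn).le
  -- powers of the logarithm times the variance factor are negligible
  have dR : ∀ r : ℝ, Dominated (fun n => Real.log n ^ r * ((n : ℝ)⁻¹ * R n))
      (fun n => Real.log n ^ (-(2 * α / β))) := by
    intro r
    obtain ⟨C, hC0, hC⟩ := dominated_log_rpow (r + s + 2 * α / β) (by norm_num : (0 : ℝ) < 1 / 2)
    refine .of_le (C := c * C) (by positivity) fun n hn => ?_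
    have hl := log_natCast_pos hn
    have hn0 : (0 : ℝ) < n := by positivity
    have e1 : Real.log n ^ r * Real.log n ^ s =
        Real.log n ^ (r + s + 2 * α / β) * Real.log n ^ (-(2 * α / β)) := by
      rw [← Real.rpow_add hl, ← Real.rpow_add hl]; congr 1; ring
    have e2 : (n : ℝ) ^ (1 / 2 : ℝ) * (n : ℝ) ^ (1 / 2 : ℝ) = n := by
      rw [← Real.rpow_add hn0]; norm_num
    calc Real.log n ^ r * ((n : ℝ)⁻¹ * R n)
        = c * (Real.log n ^ r * Real.log n ^ s) * ((n : ℝ)⁻¹ * (n : ℝ) ^ (1 / 2 : ℝ)) := by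
          simp only [hRdef]; ring
      _ = c * (Real.log n ^ (r + s + 2 * α / β) * Real.log n ^ (-(2 * α / β))) *
          ((n : ℝ)⁻¹ * (n : ℝ) ^ (1 / 2 : ℝ)) := by rw [e1]
      _ ≤ c * ((C * (n : ℝ) ^ (1 / 2 : ℝ)) * Real.log n ^ (-(2 * α / β))) *
          ((n : ℝ)⁻¹ * (n : ℝ) ^ (1 / 2 : ℝ)) := by
          gcongr
          exact hC n hn
      _ = c * C * Real.log n ^ (-(2 * α / β)) *
          ((n : ℝ)⁻¹ * ((n : ℝ) ^ (1 / 2 : ℝ) * (n : ℝ) ^ (1 / 2 : ℝ))) := by ring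
      _ = _ := by rw [e2, inv_mul_cancel₀ hn0.ne', mul_one]
  have hR0 : ∀ n : ℕ, 2 ≤ n → 0 ≤ (n : ℝ)⁻¹ * R n := fun n hn => by
    have := hlog0 s n hn
    simp only [hRdef]
    positivity
  have dstoch : Dominated (fun n => (1 + W) ^ 2 * Real.log (3 * n) ^ 2 *
      ((n : ℝ)⁻¹ * (R n * (2 / h n)))) (fun n => Real.log n ^ (-(2 * α / β))) := by
    obtain ⟨C, hC0, hC⟩ := dominated_log_three_mul_sq
    refine (Dominated.of_le (C := (1 + W) ^ 2 * C * (2 / κ)) (by positivity) fun n hn => ?_).trans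
      (dR (2 + 1 / β))
    have hl := log_natCast_pos hn
    have hRn := hR0 n hn
    have e1 : 2 / h n = 2 / κ * Real.log n ^ (1 / β) := by
      simp only [hh]
      rw [Real.rpow_neg hl.le]
      field_simp
    rw [e1]
    calc (1 + W) ^ 2 * Real.log (3 * n) ^ 2 *
          ((n : ℝ)⁻¹ * (R n * (2 / κ * Real.log n ^ (1 / β))))
        = (1 + W) ^ 2 * Real.log (3 * n) ^ 2 * (2 / κ) * Real.log n ^ (1 / β) *
          ((n : ℝ)⁻¹ * R n) := by ring
      _ ≤ (1 + W) ^ 2 * (C * Real.log n ^ (2 : ℝ)) * (2 / κ) * Real.log n ^ (1 / β) *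
          ((n : ℝ)⁻¹ * R n) := by
          gcongr
          exact hC n hn
      _ = _ := by
          rw [Real.rpow_add hl]
          ring
  -- The factor `h` of the squared atom bias cancels `1/h` and leaves `h^(2α)`, exactly the target
  -- rate; a logarithm here would spoil it.
  have dbias : Dominated (fun n => 8 * (1 + W) ^ 2 / h n * (8 / δ ^ 2 * atomBias α K U (h n)))
      (fun n => Real.log n ^ (-(2 * α / β))) := by
    refine (Dominated.of_le (C := 8 * (1 + W) ^ 2 * (8 / δ ^ 2) * (U ^ 2 * K)) (by positivity)
      fun n hn => ?_).trans dpow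
    have := hh0 n hn
    rw [atomBias]
    apply le_of_eq
    field_simp
  have dvar : Dominated (fun n => 8 * (1 + W) ^ 2 / h n * ((8 / δ ^ 2 + 4 * Real.log (3 * n) ^ 2) *
      atomVariance k U (R n) (h n) n)) (fun n => Real.log n ^ (-(2 * α / β))) := by
    obtain ⟨C, hC0, hC⟩ := dominated_log_three_mul_sq
    refine (Dominated.of_le (C := 8 * (1 + W) ^ 2 * (U ^ 2 * Z) * ((8 / δ ^ 2 + 4) * C))
      (by positivity) fun n hn => ?_).trans (dR 2)
    have hhn := hh0 n hn
    have hRn := hR0 n hn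
    have h1 := one_le_log_three_mul hn
    have h2 : 8 / δ ^ 2 + 4 * Real.log (3 * n) ^ 2 ≤
        (8 / δ ^ 2 + 4) * (C * Real.log n ^ (2 : ℝ)) := by
      calc 8 / δ ^ 2 + 4 * Real.log (3 * n) ^ 2
          ≤ 8 / δ ^ 2 * Real.log (3 * n) ^ 2 + 4 * Real.log (3 * n) ^ 2 := by
            gcongr
            exact le_mul_of_one_le_right (by positivity) (one_le_pow₀ h1)
        _ = (8 / δ ^ 2 + 4) * Real.log (3 * n) ^ 2 := by ring
        _ ≤ _ := by gcongr; exact hC n hn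
    calc 8 * (1 + W) ^ 2 / h n * ((8 / δ ^ 2 + 4 * Real.log (3 * n) ^ 2) *
          atomVariance k U (R n) (h n) n)
        = 8 * (1 + W) ^ 2 * (U ^ 2 * Z) * (8 / δ ^ 2 + 4 * Real.log (3 * n) ^ 2) *
          ((n : ℝ)⁻¹ * R n) := by
          rw [atomVariance, ← hZdef]
          field_simp
      _ ≤ 8 * (1 + W) ^ 2 * (U ^ 2 * Z) * ((8 / δ ^ 2 + 4) * (C * Real.log n ^ (2 : ℝ))) *
          ((n : ℝ)⁻¹ * R n) := by gcongr
      _ = _ := by ring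
  have hlim : Tendsto h atTop (𝓝 0) := by
    have h1 : Tendsto (fun n : ℕ => Real.log n ^ (-(1 / β))) atTop (𝓝 0) :=
      (tendsto_rpow_neg_atTop (by positivity)).comp
        (Real.tendsto_log_atTop.comp tendsto_natCast_atTop_atTop)
    have h2 := h1.const_mul κ
    rwa [mul_zero] at h2
  have hblim : Tendsto (fun n => atomBias α K U (h n)) atTop (𝓝 0) := by
    have h1 := hlim.rpow_const (p := 2 * α) (Or.inr (by positivity))
    rw [Real.zero_rpow (by positivity)] at h1
    simpa [atomBias] using (hlim.mul h1).const_mul (U ^ 2 * K)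
  -- The indicator vanishes once `log (3n) ≥ 1/δ` and the atom bias bound has dropped to `δ²/16`.
  have dsmall : Dominated (fun n => 8 * (1 + W) ^ 2 / h n * (4 * Real.log (3 * n) ^ 2 *
      if δ < (Real.log (3 * n))⁻¹ ∨ δ ^ 2 / 16 < atomBias α K U (h n) then 1 else 0))
      (fun n => Real.log n ^ (-(2 * α / β))) := by
    refine .of_eventually_zero ?_ hpos
    filter_upwards [tendsto_inv_log_three_mul.eventually (ge_mem_nhds hδ),
      hblim.eventually (ge_mem_nhds (by positivity : 0 < δ ^ 2 / 16))] with n h1 h2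
    rw [if_neg (by push Not; exact ⟨h1, h2⟩), mul_zero, mul_zero]
  have dW := dpow.const_mul (by positivity : 0 ≤ W ^ 2 * K)
  refine Dominated.trans (.of_le zero_le_one fun n hn => ?_)
    ((((dstoch.add dbias).add dsmall).add dvar).add dW)
  rw [one_mul]
  apply le_of_eq
  ring

end

/-! ### Rate in the ordinary smooth case. -/

noncomputable section

variable {α K pstar : ℝ} {k φu φw : ℝ → ℝ}

theorem rpow_neg_le_of_le_mul {x y C s : ℝ} (hx : 0 < x) (hy : 0 < y) (hC : 0 < C) (hs : 0 ≤ s)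
    (h : y ≤ C * x) : x ^ (-s) ≤ C ^ s * y ^ (-s) := by
  rw [Real.rpow_neg hx.le, Real.rpow_neg hy.le, ← div_eq_mul_inv, ← Real.div_rpow hC.le hy.le,
    ← Real.inv_rpow hx.le]
  refine Real.rpow_le_rpow (by positivity) ?_ hs
  rw [inv_le_iff_one_le_mul₀ hx, div_mul_eq_mul_div, one_le_div hy]
  exact h

theorem worstMise_splitEstimator_ordinarySmooth (hα : 0 < α) (hK : 0 < K) (hpstar : pstar < 1)
    (hk : IsProbDensity k) (hu : IsAtomKernelFT φu α) (hw : IsDensityKernelFT φw α)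
    {β : ℝ} (hβ : 0 < β) (hZ : OrdinarySmooth (densityCF k) β) {d d' : ℝ} (hd : 0 < d)
    (hd' : 0 < d') :
    ∃ C : ℝ, ∀ n : ℕ, 2 ≤ n →
      worstMise n α K pstar k
          (splitEstimator (densityCF k) φu φw n
            (d * ((n - n / 2 : ℕ) : ℝ) ^ (-(1 / (2 * α + 2 * β + 1))))
            (d' * ((n / 2 : ℕ) : ℝ) ^ (-(1 / (2 * α + 2 * β))))
            (Real.log (3 * n))⁻¹)
        ≤ ENNReal.ofReal (C * (n : ℝ) ^ (-(2 * α / (2 * α + 2 * β + 1)))) := by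
  obtain ⟨U, hU0, hU⟩ := hu.bound
  obtain ⟨W, hW0, hW⟩ := hw.bound
  obtain ⟨c, hc0, hR⟩ := hZ.exists_inv_norm_sq_le (continuous_densityCF hk) hβ hd
  obtain ⟨c', hc0', hRg⟩ := hZ.exists_inv_norm_sq_le (continuous_densityCF hk) hβ hd'
  set ρ := 1 / (2 * α + 2 * β + 1) with hρ
  set σ := 1 / (2 * α + 2 * β) with hσ
  have hρ0 : 0 < ρ := by positivity
  have hσ0 : 0 < σ := by positivity
  have hρ1 : ρ * (2 * α + 2 * β + 1) = 1 := by rw [hρ]; field_simp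
  have hσ1 : σ * (2 * α + 2 * β) = 1 := by rw [hσ]; field_simp
  -- The gap `σ - ρ` is the polynomial margin that absorbs the squared logarithm.
  have hσρ : ρ < σ := by
    rw [hρ, hσ]
    exact one_div_lt_one_div_of_lt (by positivity) (by linarith)
  have hrate : 2 * α / (2 * α + 2 * β + 1) = 2 * α * ρ := by rw [hρ]; ring
  rw [hrate]
  set δ := 1 - pstar with hδdef
  have hδ : 0 < δ := sub_pos.2 hpstar
  set Z := ∫ t, ‖densityCF k t‖ with hZdef
  have hZ0 : 0 ≤ Z := integral_nonneg fun t => norm_nonneg _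
  set m : ℕ → ℝ := fun n => ((n / 2 : ℕ) : ℝ) with hm
  set m' : ℕ → ℝ := fun n => ((n - n / 2 : ℕ) : ℝ) with hm'
  set h : ℕ → ℝ := fun n => d * m' n ^ (-ρ) with hh
  set g : ℕ → ℝ := fun n => d' * m n ^ (-σ) with hg
  have hm1 : ∀ n, 2 ≤ n → 1 ≤ m n := fun n hn => by
    simp only [hm]; exact_mod_cast (by omega : 1 ≤ n / 2)
  have hm1' : ∀ n, 2 ≤ n → 1 ≤ m' n := fun n hn => by
    simp only [hm']; exact_mod_cast (by omega : 1 ≤ n - n / 2)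
  have hmn : ∀ n : ℕ, 2 ≤ n → (n : ℝ) ≤ 3 * m n := fun n hn => by
    simp only [hm]; exact_mod_cast (by omega : n ≤ 3 * (n / 2))
  have hmn' : ∀ n : ℕ, 2 ≤ n → (n : ℝ) ≤ 2 * m' n := fun n hn => by
    simp only [hm']; exact_mod_cast (by omega : n ≤ 2 * (n - n / 2))
  have hmle' : ∀ n : ℕ, m' n ≤ n := fun n => by
    simp only [hm']; exact_mod_cast (by omega : n - n / 2 ≤ n)
  have hh0 : ∀ n, 2 ≤ n → 0 < h n := fun n hn => by
    have := hm1' n hn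
    positivity
  have hg0 : ∀ n, 2 ≤ n → 0 < g n := fun n hn => by
    have := hm1 n hn
    positivity
  have hhd : ∀ n, 2 ≤ n → h n ≤ d := fun n hn =>
    mul_le_of_le_one_right hd.le (Real.rpow_le_one_of_one_le_of_nonpos (hm1' n hn) (by linarith))
  have hgd : ∀ n, 2 ≤ n → g n ≤ d' := fun n hn =>
    mul_le_of_le_one_right hd'.le (Real.rpow_le_one_of_one_le_of_nonpos (hm1 n hn) (by linarith))
  set E : ℕ → ℝ := fun n => Real.log (3 * n) ^ 2 * (4 * atomBias α K U (g n) +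
      if δ < (Real.log (3 * n))⁻¹ then 2 else 0) +
    4 * Real.log (3 * n) ^ 2 * atomVariance k U (c' * g n ^ (-(2 * β))) (g n) (n / 2) with hEdef
  refine exists_const_of_dominated ?_ fun n hn =>
    worstMise_splitEstimator_le hα hK hpstar hk hZ.ne_zero hZ.integrable hu hw hU hW0 hW hn
      (one_le_log_three_mul hn) (hh0 n hn) (hg0 n hn) (hR _ (hh0 n hn) (hhd n hn))
      (hRg _ (hg0 n hn) (hgd n hn)) (E := E n) le_rfl
  have hn0 : ∀ n : ℕ, 2 ≤ n → (0 : ℝ) < n := fun n hn => by positivity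
  have hpos : ∀ n : ℕ, 2 ≤ n → 0 < (n : ℝ) ^ (-(2 * α * ρ)) := fun n hn =>
    Real.rpow_pos_of_pos (hn0 n hn) _
  have hle1 : ∀ n : ℕ, 2 ≤ n → (n : ℝ) ^ (-(2 * α * ρ)) ≤ 1 := fun n hn =>
    Real.rpow_le_one_of_one_le_of_nonpos (by exact_mod_cast (by omega : 1 ≤ n))
      (neg_nonpos.2 (by positivity))
  have dm' : Dominated (fun n => m' n ^ (-(2 * α * ρ))) (fun n => (n : ℝ) ^ (-(2 * α * ρ))) :=
    .of_le (by positivity) fun n hn => rpow_neg_le_of_le_mul (by linarith [hm1' n hn]) (hn0 n hn)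
      two_pos (by positivity) (hmn' n hn)
  have dpow : Dominated (fun n => h n ^ (2 * α)) (fun n => (n : ℝ) ^ (-(2 * α * ρ))) := by
    refine (Dominated.of_le (C := d ^ (2 * α)) (by positivity) fun n hn => le_of_eq ?_).trans dm'
    have hx : 0 < m' n := by linarith [hm1' n hn]
    simp only [hh]
    rw [Real.mul_rpow hd.le (by positivity), ← Real.rpow_mul hx.le]
    congr 2
    ring
  have dstoch : Dominated (fun n => (m' n)⁻¹ * (c * h n ^ (-(2 * β)) * (2 / h n)))
      (fun n => (n : ℝ) ^ (-(2 * α * ρ))) := by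
    refine (Dominated.of_le (C := 2 * c * d ^ (-(2 * β)) / d) (by positivity)
      fun n hn => le_of_eq ?_).trans dm'
    have hx : 0 < m' n := by linarith [hm1' n hn]
    have e1 : h n ^ (-(2 * β)) = d ^ (-(2 * β)) * m' n ^ (2 * β * ρ) := by
      simp only [hh]
      rw [Real.mul_rpow hd.le (by positivity), ← Real.rpow_mul hx.le]
      congr 2
      ring
    have e2 : 2 / h n = 2 / d * m' n ^ ρ := by
      simp only [hh]
      rw [Real.rpow_neg hx.le]
      field_simp
    -- The choice of `ρ` balances variance and squared bias: `-1 + 2βρ + ρ = -2αρ`.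
    have e3 : (m' n)⁻¹ * (m' n ^ (2 * β * ρ) * m' n ^ ρ) = m' n ^ (-(2 * α * ρ)) := by
      rw [← Real.rpow_neg_one, ← Real.rpow_add hx, ← Real.rpow_add hx]
      congr 1
      linarith
    rw [e1, e2, ← e3]
    ring
  -- the mean squared error of the estimator of the atom
  have dlog : Dominated (fun n => Real.log (3 * n) ^ 2)
      (fun n => (n : ℝ) ^ ((2 * α + 1) * (σ - ρ))) :=
    dominated_log_three_mul_sq.trans
      (dominated_log_rpow 2 (mul_pos (by positivity) (sub_pos.2 hσρ)))
  -- Spending `n^((2α+1)(σ-ρ))` on the logarithm closes the balance exactly: `(2α+1)(σ-ρ) + ρ -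
  -- (2α+1)σ = -2αρ`.
  have drate : Dominated (fun n => Real.log (3 * n) ^ 2 * (n : ℝ) ^ ρ * m n ^ (-((2 * α + 1) * σ)))
      (fun n => (n : ℝ) ^ (-(2 * α * ρ))) := by
    obtain ⟨C, hC0, hC⟩ := dlog
    refine .of_le (C := C * 3 ^ ((2 * α + 1) * σ)) (by positivity) fun n hn => ?_
    have hx : 0 < m n := by linarith [hm1 n hn]
    have hn' := hn0 n hn
    have e1 := rpow_neg_le_of_le_mul hx hn' (by norm_num : (0 : ℝ) < 3)
      (by positivity : 0 ≤ (2 * α + 1) * σ) (hmn n hn)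
    calc Real.log (3 * n) ^ 2 * (n : ℝ) ^ ρ * m n ^ (-((2 * α + 1) * σ))
        ≤ C * (n : ℝ) ^ ((2 * α + 1) * (σ - ρ)) * (n : ℝ) ^ ρ *
          (3 ^ ((2 * α + 1) * σ) * (n : ℝ) ^ (-((2 * α + 1) * σ))) := by
          gcongr
          exact hC n hn
      _ = C * 3 ^ ((2 * α + 1) * σ) * ((n : ℝ) ^ ((2 * α + 1) * (σ - ρ)) * (n : ℝ) ^ ρ *
          (n : ℝ) ^ (-((2 * α + 1) * σ))) := by ring
      _ = _ := by
          rw [← Real.rpow_add hn', ← Real.rpow_add hn']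
          congr 2
          ring
  have hinv : ∀ n, 2 ≤ n → 1 / h n ≤ d⁻¹ * (n : ℝ) ^ ρ := by
    intro n hn
    have hx : 0 < m' n := by linarith [hm1' n hn]
    simp only [hh]
    rw [Real.rpow_neg hx.le, one_div, mul_inv, inv_inv]
    gcongr
    exact hmle' n
  have hbias : ∀ n, 2 ≤ n → atomBias α K U (g n) =
      U ^ 2 * K * (d' * d' ^ (2 * α)) * m n ^ (-((2 * α + 1) * σ)) := by
    intro n hn
    have hx : 0 < m n := by linarith [hm1 n hn]
    have e : m n ^ (-((2 * α + 1) * σ)) = m n ^ (-σ) * m n ^ (-σ * (2 * α)) := by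
      rw [← Real.rpow_add hx]; congr 1; ring
    simp only [atomBias, hg]
    rw [Real.mul_rpow hd'.le (by positivity), ← Real.rpow_mul hx.le, e]
    ring
  -- By the choice of `σ`, the variance exponent `-1 - σ + 2βσ` equals `-(2α+1)σ`, that of the
  -- squared bias.
  have hvar : ∀ n, 2 ≤ n → atomVariance k U (c' * g n ^ (-(2 * β))) (g n) (n / 2) =
      U ^ 2 * Z * c' * (d' * d' ^ (-(2 * β))) * m n ^ (-((2 * α + 1) * σ)) := by
    intro n hn
    have hx : 0 < m n := by linarith [hm1 n hn]
    have e : m n ^ (-((2 * α + 1) * σ)) = (m n)⁻¹ * (m n ^ (-σ) * m n ^ (-σ * (-(2 * β)))) := by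
      rw [← Real.rpow_neg_one, ← Real.rpow_add hx, ← Real.rpow_add hx]
      congr 1
      linarith
    simp only [atomVariance, ← hZdef]
    change (m n)⁻¹ * _ = _
    simp only [hg]
    rw [Real.mul_rpow hd'.le (by positivity), ← Real.rpow_mul hx.le, e]
    ring
  set A := 4 * (U ^ 2 * K * (d' * d' ^ (2 * α))) +
    4 * (U ^ 2 * Z * c' * (d' * d' ^ (-(2 * β)))) with hA
  have hA0 : 0 ≤ A := by positivity
  have dmain : Dominated (fun n => 1 / h n * (Real.log (3 * n) ^ 2 *
      (A * m n ^ (-((2 * α + 1) * σ))))) (fun n => (n : ℝ) ^ (-(2 * α * ρ))) := by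
    refine (Dominated.of_le (C := d⁻¹ * A) (by positivity) fun n hn => ?_).trans drate
    have hx : 0 < m n := by linarith [hm1 n hn]
    calc 1 / h n * (Real.log (3 * n) ^ 2 * (A * m n ^ (-((2 * α + 1) * σ))))
        ≤ d⁻¹ * (n : ℝ) ^ ρ * (Real.log (3 * n) ^ 2 * (A * m n ^ (-((2 * α + 1) * σ)))) := by
          gcongr
          exact hinv n hn
      _ = _ := by ring
  have dsmall : Dominated (fun n => 1 / h n * (Real.log (3 * n) ^ 2 *
      if δ < (Real.log (3 * n))⁻¹ then 2 else 0)) (fun n => (n : ℝ) ^ (-(2 * α * ρ))) := by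
    refine .of_eventually_zero ?_ hpos
    filter_upwards [tendsto_inv_log_three_mul.eventually (ge_mem_nhds hδ)] with n h1
    rw [if_neg (not_lt.2 h1), mul_zero, mul_zero]
  have dE : Dominated (fun n => 1 / h n * E n) (fun n => (n : ℝ) ^ (-(2 * α * ρ))) := by
    refine Dominated.trans (.of_le zero_le_one fun n hn => ?_) (dmain.add dsmall)
    rw [one_mul]
    apply le_of_eq
    simp only [hEdef, hbias n hn, hvar n hn, hA]
    ring
  -- Boundedness of `E` suffices for the factor `1 + E` in the stochastic term; it follows from the
  -- bound on `E / h` because `h ≤ d`.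
  have hEb : ∃ B, 0 ≤ B ∧ ∀ n, 2 ≤ n → E n ≤ B := by
    obtain ⟨C, hC0, hC⟩ := dE
    refine ⟨d * C, by positivity, fun n hn => ?_⟩
    have hhn := hh0 n hn
    have h1 : 1 / h n * E n ≤ C :=
      (hC n hn).trans (mul_le_of_le_one_right hC0 (hle1 n hn))
    rw [one_div_mul_eq_div, div_le_iff₀ hhn, mul_comm] at h1
    exact h1.trans (by gcongr; exact hhd n hn)
  obtain ⟨B, hB0, hB⟩ := hEb
  have dfirst : Dominated (fun n => (1 + W) ^ 2 * (2 / δ ^ 2 * (1 + E n)) *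
      ((m' n)⁻¹ * (c * h n ^ (-(2 * β)) * (2 / h n)))) (fun n => (n : ℝ) ^ (-(2 * α * ρ))) := by
    refine (Dominated.of_le (C := (1 + W) ^ 2 * (2 / δ ^ 2 * (1 + B))) (by positivity)
      fun n hn => ?_).trans dstoch
    have := hm1' n hn
    have := hh0 n hn
    gcongr
    exact hB n hn
  refine Dominated.trans (.of_le zero_le_one fun n hn => ?_)
    ((dfirst.add (dE.const_mul (by positivity : 0 ≤ 8 * (1 + W) ^ 2))).add
      (dpow.const_mul (by positivity : 0 ≤ W ^ 2 * K)))
  rw [one_mul]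
  apply le_of_eq
  ring

end

theorem theorem2
    (α K pstar : ℝ) (hα : 0 < α) (hK : 0 < K) (hpstar : pstar < 1)
    (k : ℝ → ℝ) (hk : IsProbDensity k)
    (φu φw : ℝ → ℝ) (hu : IsAtomKernelFT φu α) (hw : IsDensityKernelFT φw α) :
    (∀ β : ℝ, 0 < β → OrdinarySmooth (densityCF k) β →
      ∀ d d' : ℝ, 0 < d → 0 < d' →
        ∃ C : ℝ, ∀ n : ℕ, 2 ≤ n →
          worstMise n α K pstar k
              (splitEstimator (densityCF k) φu φw n
                (d * ((n - n / 2 : ℕ) : ℝ) ^ (-(1 / (2 * α + 2 * β + 1))))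
                (d' * ((n / 2 : ℕ) : ℝ) ^ (-(1 / (2 * α + 2 * β))))
                (Real.log (3 * n))⁻¹)
            ≤ ENNReal.ofReal (C * (n : ℝ) ^ (-(2 * α / (2 * α + 2 * β + 1))))) ∧
    (∀ β γ : ℝ, 0 < β → 0 < γ → Supersmooth (densityCF k) β γ →
        ∃ C : ℝ, ∀ n : ℕ, 2 ≤ n →
          worstMise n α K pstar k
              (fullEstimator (densityCF k) φu φw n
                ((4 / γ) ^ (1 / β) * Real.log n ^ (-(1 / β)))
                ((4 / γ) ^ (1 / β) * Real.log n ^ (-(1 / β)))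
                (Real.log (3 * n))⁻¹)
            ≤ ENNReal.ofReal (C * Real.log n ^ (-(2 * α / β)))) :=
  ⟨fun _ hβ hZ _ _ hd hd' =>
      worstMise_splitEstimator_ordinarySmooth hα hK hpstar hk hu hw hβ hZ hd hd',
    fun _ _ hβ hγ hZ => worstMise_fullEstimator_supersmooth hα hK hpstar hk hu hw hβ hγ hZ⟩
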